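/- **Setting.** There are $W$ workers, of which $B$ are Byzantine and the other $R=W-B$ (the set $\mathcal R$) are regular, with $B<W/2$. Let $f(x)=\frac1R\sum_{\omega\in\mathcal R}f_\omega(x)$ and $f_\omega(x)=\frac1J\sum_{j=1}^J f_{\omega,j}(x)$ for $x\in\mathbb R^p$, $p\ge1$, and let $x^*$ minimize $f$. Assume: 1. $f(x)\ge f(y)+\langle\nabla f(y),x-y\rangle+\frac\mu2\|x-y\|^2$ for all $x,y$, where $\mu>0$, and every sample cost $f_{\omega,j}$ ($\omega\in\mathcal R$) is differentiable with $L$-Lipschitz gradient (hence so is $f$); 2. $\frac1R\sum_{\omega\in\mathcal R}\|\nabla f_\omega(x)-\nabla f(x)\|^2\le\sigma^2$ for all $x$. Let $\mathcal Q$ be an unbiased compressor with parameter $\delta\ge0$, that is, a randomized operator on $\mathbb R^p$ with $E[\mathcal Q(x)]=x$ and $E\|\mathcal Q(x)-x\|^2\le\delta\|x\|^2$ for all $x$. **Algorithm (BROADCAST)** with step size $\gamma>0$ and hyperparameter $\beta$. Start from deterministic $x^0$ and $h_\omega^0$, and set $\phi^0_{\omega,j}=x^0$. At iteration $t$, every regular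 worker $\omega$ draws an index $i_\omega^t$ uniformly from $\{1,\dots,J\}$, forms $$g_\omega^t=\nabla f_{\omega,i_\omega^t}(x^t)-\nabla f_{\omega,i_\omega^t}(\phi_{\omega,i_\omega^t}^t)+\frac1J\sum_{j=1}^J\nabla f_{\omega,j}(\phi_{\omega,j}^t),$$ sends $m_\omega^t=\mathcal Q(g_\omega^t-h_\omega^t)$ (the randomness of $\mathcal Q$ and $i_\omega^t$ being independent of each other and of the past), and sets $\phi^{t+1}_{\omega,i_\omega^t}=x^t$ and $\phi^{t+1}_{\omega,j}=\phi^t_{\omega,j}$ for $j\ne i_\omega^t$. Byzantine workers send arbitrary vectors $m_\omega^t$. The master computes a vector $z^t$ that is an $\epsilon$-approximate geometric median ($\epsilon\ge0$) of the vectors $\hat g_\omega^t=h_\omega^t+m_\omega^t$ of all workers, that is, $$\sum_\omega\|z^t-\hat g_\omega^t\|\le\inf_v\sum_\omega\|v-\hat g_\omega^t\|+\epsilon,$$ and sets $x^{t+1}=x^t-\gamma z^t$ and $h_\omega^{t+1}=h_\omega^t+\beta m_\omega^t$ for all $\omega$. The vectors $z^t$ do not depend on draws made after iteration $t$. **Theorem.**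 Put $\alpha=B/W$ and $C_\alpha=\frac{2-2\alpha}{1-2\alpha}$. If $$\delta C_\alpha^2\le\frac{\mu^2}{56L^2},\qquad \beta(1+\delta)\le1,\qquad 0<\gamma\le\frac{\beta\mu}{4\sqrt{35}\,\sqrt{1+5\delta}\;J^2L^2C_\alpha},$$ then for every $t\ge0$ the expectation $E\|x^t-x^*\|^2$ is finite. If moreover $h_\omega^0=0$ for all $\omega\in\mathcal R$ (or $\delta=0$), then $$E\|x^t-x^*\|^2\le\Big(1-\frac{\gamma\mu}2\Big)^t\Delta_1+\Delta_2,\qquad \Delta_1=\|x^0-x^*\|^2-\Delta_2,$$ $$\Delta_2=\frac{70}{17\mu^2}\Big(2(1+6\delta)C_\alpha^2\sigma^2+\frac{2\epsilon^2}{(W-2B)^2}\Big).$$ For arbitrary $h_\omega^0$ the same bound holds with $$\Delta_1=\|x^0-x^*\|^2+\frac{280\,\delta C_\alpha^2\gamma}{17\beta\mu}\cdot\frac1R\sum_{\omega\in\mathcal R}\|h_\omega^0\|^2-\Delta_2.$$ In particular the asymptotic error $\Delta_2$ contains neither an inner-variation term nor a compression-noise term. -/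

import Mathlib

open MeasureTheory ProbabilityTheory

noncomputable section

/-- The parameter space `ℝ^p` with its Euclidean norm. -/
abbrev Param (p : ℕ) : Type := EuclideanSpace ℝ (Fin p)

/-- The local cost `f_ω = (1/J) ∑_j f_{ω,j}` of worker `ω`. -/
def localCost {𝒲 : Type*} {p J : ℕ} (f : 𝒲 → Fin J → Param p → ℝ) (ω : 𝒲) (x : Param p) : ℝ :=
  (1 / (J : ℝ)) * ∑ j, f ω j x

/-- The global cost `f = (1/R) ∑_{ω regular} f_ω`, where `R` is the number of regular workers. -/
def globalCost {𝒲 : Type*} {p J : ℕ} (f : 𝒲 → Fin J → Param p → ℝ) (reg : Finset 𝒲)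
    (x : Param p) : ℝ :=
  (1 / (reg.card : ℝ)) * ∑ ω ∈ reg, localCost f ω x

/-- Strong convexity of the global cost and Lipschitz continuity (with one constant `L`) of the
gradients of the sample costs of the regular workers. The latter contains the `L`-Lipschitz
continuity of the gradients of the averages `localCost` and `globalCost`. -/
structure StronglyConvexAndSmooth {𝒲 : Type*} {p J : ℕ} (f : 𝒲 → Fin J → Param p → ℝ)
    (reg : Finset 𝒲) (μ L : ℝ) : Prop where
  differentiable : ∀ ω ∈ reg, ∀ j, Differentiable ℝ (f ω j)
  lipschitz : ∀ ω ∈ reg, ∀ j, ∀ x y,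
    ‖gradient (f ω j) x - gradient (f ω j) y‖ ≤ L * ‖x - y‖
  strongly_convex : ∀ x y,
    globalCost f reg x ≥ globalCost f reg y
      + inner ℝ (gradient (globalCost f reg) y) (x - y) + μ / 2 * ‖x - y‖ ^ 2

/-- Bounded outer variation (heterogeneity of the regular workers). -/
def BoundedOuterVariation {𝒲 : Type*} {p J : ℕ} (f : 𝒲 → Fin J → Param p → ℝ)
    (reg : Finset 𝒲) (σ : ℝ) : Prop :=
  ∀ x, (1 / (reg.card : ℝ)) *
    ∑ ω ∈ reg, ‖gradient (localCost f ω) x - gradient (globalCost f reg) x‖ ^ 2 ≤ σ ^ 2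

/-- A randomized operator on `ℝ^p` is a jointly measurable map `Q : S → ℝ^p → ℝ^p` whose first
argument is a random seed of law `ν`. It is an unbiased compressor with parameter `δ` if
`E[Q(x)] = x` and `E‖Q(x) - x‖² ≤ δ‖x‖²` for all `x`. -/
structure IsUnbiasedCompressor {S : Type*} [MeasurableSpace S] {p : ℕ} (ν : Measure S)
    (Q : S → Param p → Param p) (δ : ℝ) : Prop where
  nonneg : 0 ≤ δ
  measurable : Measurable (fun q : S × Param p => Q q.1 q.2)
  integrable : ∀ x, Integrable (fun s => Q s x) ν
  integrable_sq : ∀ x, Integrable (fun s => ‖Q s x - x‖ ^ 2) ν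
  unbiased : ∀ x, ∫ s, Q s x ∂ν = x
  variance_le : ∀ x, ∫ s, ‖Q s x - x‖ ^ 2 ∂ν ≤ δ * ‖x‖ ^ 2

/-- `z` is an `ε`-approximate geometric median of the vectors `v ω`, `ω ∈ 𝒲`. -/
def IsApproxGeomMedian {𝒲 : Type*} [Fintype 𝒲] {p : ℕ} (ε : ℝ) (v : 𝒲 → Param p)
    (z : Param p) : Prop :=
  ∑ ω, ‖z - v ω‖ ≤ (⨅ u : Param p, ∑ ω, ‖u - v ω‖) + ε

/-- The SAGA-corrected stochastic gradient of a worker with sample costs `f j`, at the point `x`,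
with table points `φ j` and sampled index `i`. -/
def sagaGradient {p J : ℕ} (f : Fin J → Param p → ℝ) (x : Param p) (φ : Fin J → Param p)
    (i : Fin J) : Param p :=
  gradient (f i) x - gradient (f i) (φ i) + (1 / (J : ℝ)) • ∑ j, gradient (f j) (φ j)

/-- The processes below form a run of the algorithm BROADCAST with step size `γ`, hyperparameter
`β`, started at `x₀` and `h₀`, on the probability space `(Ω, P)`. The σ-algebra `ℱ t` is the
information available before iteration `t`.
* `x t` : the model parameter;
* `φ t ω j` : the point at which the stored gradient of sample `j` of worker `ω` was computed;
* `h t ω` : the auxiliary vector of worker `ω` (maintained by the master for all workers);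
* `i t ω`, `ξ t ω` : the sampled index and the seed of the compressor of the regular worker `ω`;
* `m t ω` : the message sent by worker `ω` to the master;
* `z t` : the `ε`-approximate geometric median computed by the master.

No condition at all is put on the messages `m t ω` of the Byzantine workers `ω ∉ reg`. They may
depend on the past and on all draws of the current iteration, and may or may not be outputs of the
compressor. No independence between different workers is required. -/
structure IsBroadcastRun {Ω : Type*} {mΩ : MeasurableSpace Ω} (P : Measure Ω)
    (ℱ : Filtration ℕ mΩ) {𝒲 : Type*} [Fintype 𝒲] (reg : Finset 𝒲) {p J : ℕ}
    (f : 𝒲 → Fin J → Param p → ℝ) {S : Type*} [MeasurableSpace S] (ν : Measure S)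
    (Q : S → Param p → Param p) (γ β ε : ℝ) (x₀ : Param p) (h₀ : 𝒲 → Param p)
    (x : ℕ → Ω → Param p) (φ : ℕ → 𝒲 → Fin J → Ω → Param p) (h : ℕ → 𝒲 → Ω → Param p)
    (i : ℕ → 𝒲 → Ω → Fin J) (ξ : ℕ → 𝒲 → Ω → S) (m : ℕ → 𝒲 → Ω → Param p)
    (z : ℕ → Ω → Param p) : Prop where
  /- initialization -/
  x_zero : ∀ a, x 0 a = x₀
  φ_zero : ∀ ω ∈ reg, ∀ j a, φ 0 ω j a = x₀
  h_zero : ∀ ω a, h 0 ω a = h₀ ω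
  /- the draws of iteration `t`: the index is uniform, the seed has law `ν`, and the past, the
  index and the seed are independent; the draws belong to the past of iteration `t + 1` -/
  i_measurable : ∀ t, ∀ ω ∈ reg, Measurable[ℱ (t + 1)] (i t ω)
  ξ_measurable : ∀ t, ∀ ω ∈ reg, Measurable[ℱ (t + 1)] (ξ t ω)
  i_uniform : ∀ t, ∀ ω ∈ reg, ∀ j, P.real {a | i t ω a = j} = 1 / (J : ℝ)
  ξ_law : ∀ t, ∀ ω ∈ reg, P.map (ξ t ω) = ν
  indep_past : ∀ t, ∀ ω ∈ reg,
    Indep (ℱ t) (MeasurableSpace.comap (fun a => (i t ω a, ξ t ω a)) inferInstance) P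
  indep_draws : ∀ t, ∀ ω ∈ reg, IndepFun (i t ω) (ξ t ω) P
  /- regular workers send the compressed difference of corrected gradient and auxiliary vector -/
  message : ∀ t, ∀ ω ∈ reg, ∀ a, m t ω a =
    Q (ξ t ω a) (sagaGradient (f ω) (x t a) (fun j => φ t ω j a) (i t ω a) - h t ω a)
  /- regular workers update their table -/
  φ_succ : ∀ t, ∀ ω ∈ reg, ∀ j a,
    φ (t + 1) ω j a = if j = i t ω a then x t a else φ t ω j a
  /- the auxiliary vectors are updated with the messages -/
  h_succ : ∀ t ω a, h (t + 1) ω a = h t ω a + β • m t ω a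
  /- the master aggregates `h + m` robustly and makes a step; the aggregate is determined no later
  than the end of iteration `t` -/
  z_measurable : ∀ t, Measurable[ℱ (t + 1)] (z t)
  z_median : ∀ t a, IsApproxGeomMedian ε (fun ω => h t ω a + m t ω a) (z t a)
  x_succ : ∀ t a, x (t + 1) a = x t a - γ • z t a

/-- `C_α = (2 - 2α) / (1 - 2α)` for the fraction `α = B / W` of Byzantine workers. -/
def Calpha (W B : ℕ) : ℝ :=
  (2 - 2 * ((B : ℝ) / W)) / (1 - 2 * ((B : ℝ) / W))

/-- The asymptotic learning error `Δ₂` of BROADCAST. -/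
def broadcastDelta₂ (W B : ℕ) (μ δ σ ε : ℝ) : ℝ :=
  70 / (17 * μ ^ 2) *
    (2 * (1 + 6 * δ) * Calpha W B ^ 2 * σ ^ 2 + 2 * ε ^ 2 / ((W : ℝ) - 2 * B) ^ 2)

end

/-! The proof runs on a Lyapunov function `T = D + c₁ S + c₂ H`. Here `D` is the mean squared
distance to the minimizer, `S` the mean staleness of the regular gradient tables (the average of `‖x
- φ_j‖²`), and `H` the mean of `‖h_ω‖²` over the regular workers.

Robustness is deterministic. For every outcome, and whatever the Byzantine workers send, an
approximate geometric median is within `C_α` times the mean deviation of the regular vectors, plus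
`ε/(W - 2B)`, of any chosen centre. With centre `∇f(x)`, the step is an inexact gradient step whose
squared error is controlled by the dispersion `A` of the regular vectors `h + m`
(`IsApproxGeomMedian.norm_sub_sq_le`). Strong convexity then contracts `D` up to that error
(`norm_step_sub_sq_le`).

The dispersion is bounded by averaging over the draws of one worker at a time
(`moment_reconstruction_le`). The variance of the corrected gradient is at most `L² S`, so no inner
variation enters. The compressor adds `δ` times the second moment of `g - h`, and heterogeneity adds
`σ²`. Since `∇f` vanishes at the minimizer, the mean of `‖∇f_ω‖²` is at most `σ² + L² D`, so `A` is
bounded through `D`, `S`, `H` and `σ²` alone.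

Table refreshes contract `S` by `1 - 1/(2J)` up to a term of order `γ²`. The update of `h` contracts
`H` by `1 - β`, because `β(1+δ) ≤ 1` makes its second moment at most that of a random choice between
`h` and `g`. The weights `c₁`, `c₂` let these contractions pay for the `S` and `H` parts of the
dispersion. The bounds on `δ C_α²` and `γ` let the contraction of `D` absorb its own part
(`lyapunov_step`). What remains is `T' ≤ (1 - γμ/2) T + (γμ/2) Δ₂`, which is iterated. -/

/-! ### Weighted triangle inequalities and finite averages -/

section RealInequalities

/-- Squared form of the triangle inequality with a free weight. -/
theorem norm_add_sq_le_weighted {E : Type*} [NormedAddCommGroup E] [InnerProductSpace ℝ E]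
    (u v : E) {s : ℝ} (hs : 0 < s) :
    ‖u + v‖ ^ 2 ≤ (1 + s) * ‖u‖ ^ 2 + (1 + 1 / s) * ‖v‖ ^ 2 := by
  have h1 : ‖u + v‖ ^ 2 ≤ (‖u‖ + ‖v‖) ^ 2 := by gcongr; exact norm_add_le u v
  have h2 : (1 + s) * ‖u‖ ^ 2 + (1 + 1 / s) * ‖v‖ ^ 2 - (‖u‖ + ‖v‖) ^ 2
      = (s * ‖u‖ - ‖v‖) ^ 2 / s := by field_simp; ring
  have h3 : 0 ≤ (s * ‖u‖ - ‖v‖) ^ 2 / s := by positivity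
  linarith

theorem norm_add_sq_le_two {E : Type*} [NormedAddCommGroup E] [InnerProductSpace ℝ E]
    (u v : E) : ‖u + v‖ ^ 2 ≤ 2 * ‖u‖ ^ 2 + 2 * ‖v‖ ^ 2 := by
  have := norm_add_sq_le_weighted u v one_pos
  norm_num at this
  linarith

/-- The variance identity for a finite average. -/
theorem average_norm_sub_sq {E : Type*} [NormedAddCommGroup E] [InnerProductSpace ℝ E]
    {ι : Type*} (s : Finset ι) (hs : 0 < s.card) (g : ι → E) (c v : E)
    (hc : (1 / (s.card : ℝ)) • ∑ j ∈ s, g j = c) :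
    (1 / (s.card : ℝ)) * ∑ j ∈ s, ‖g j - v‖ ^ 2
      = (1 / (s.card : ℝ)) * ∑ j ∈ s, ‖g j - c‖ ^ 2 + ‖c - v‖ ^ 2 := by
  have hn : (s.card : ℝ) ≠ 0 := by positivity
  have hsum : ∑ j ∈ s, (g j - c) = 0 := by
    rw [Finset.sum_sub_distrib, Finset.sum_const, ← hc, ← Nat.cast_smul_eq_nsmul ℝ, smul_smul]
    simp [hn]
  have hj : ∀ j ∈ s, ‖g j - v‖ ^ 2
      = ‖g j - c‖ ^ 2 + 2 * inner ℝ (g j - c) (c - v) + ‖c - v‖ ^ 2 := by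
    intro j _
    rw [← norm_add_sq_real, sub_add_sub_cancel]
  rw [Finset.sum_congr rfl hj, Finset.sum_add_distrib, Finset.sum_add_distrib, ← Finset.mul_sum,
    ← sum_inner, hsum, inner_zero_left, Finset.sum_const, nsmul_eq_mul]
  field_simp
  ring

/-- Averaging around the mean gives the least second moment. -/
theorem average_norm_sub_sq_le {E : Type*} [NormedAddCommGroup E] [InnerProductSpace ℝ E]
    {ι : Type*} (s : Finset ι) (hs : 0 < s.card) (g : ι → E) (c v : E)
    (hc : (1 / (s.card : ℝ)) • ∑ j ∈ s, g j = c) :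
    (1 / (s.card : ℝ)) * ∑ j ∈ s, ‖g j - c‖ ^ 2
      ≤ (1 / (s.card : ℝ)) * ∑ j ∈ s, ‖g j - v‖ ^ 2 := by
  rw [average_norm_sub_sq s hs g c v hc]
  have : 0 ≤ ‖c - v‖ ^ 2 := by positivity
  linarith

theorem average_le_of_forall_le {ι : Type*} {s : Finset ι} (hs : 0 < s.card) {g : ι → ℝ} {b : ℝ}
    (h : ∀ j ∈ s, g j ≤ b) : (1 / (s.card : ℝ)) * ∑ j ∈ s, g j ≤ b := by
  have hn : (0 : ℝ) < s.card := by exact_mod_cast hs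
  have := Finset.sum_le_sum h
  rw [Finset.sum_const, nsmul_eq_mul] at this
  rw [one_div, inv_mul_le_iff₀ hn]
  exact this

theorem average_mono {ι : Type*} {s : Finset ι} {g g' : ι → ℝ} (h : ∀ j ∈ s, g j ≤ g' j) :
    (1 / (s.card : ℝ)) * ∑ j ∈ s, g j ≤ (1 / (s.card : ℝ)) * ∑ j ∈ s, g' j :=
  mul_le_mul_of_nonneg_left (Finset.sum_le_sum h) (by positivity)

/-- The square of an average is at most the average of the squares. -/
theorem sq_average_le {ι : Type*} (s : Finset ι) (g : ι → ℝ) :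
    ((1 / (s.card : ℝ)) * ∑ j ∈ s, g j) ^ 2 ≤ (1 / (s.card : ℝ)) * ∑ j ∈ s, g j ^ 2 := by
  rcases Nat.eq_zero_or_pos s.card with h0 | h0
  · simp [h0]
  have hn : (0 : ℝ) < s.card := by exact_mod_cast h0
  have := sq_sum_le_card_mul_sum_sq (s := s) (f := g)
  rw [mul_pow, one_div, inv_pow, inv_mul_le_iff₀ (by positivity)]
  calc _ ≤ _ := this
    _ = _ := by field_simp

end RealInequalities

/-! ### Robustness of the approximate geometric median -/

section GeometricMedian

variable {𝒲 : Type*} [Fintype 𝒲] {p : ℕ}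

/-- An approximate geometric median is close to `c` when the regular vectors are. -/
theorem IsApproxGeomMedian.card_mul_norm_sub_le {ε : ℝ} {v : 𝒲 → Param p} {z : Param p}
    (hz : IsApproxGeomMedian ε v z) (reg : Finset 𝒲) {B : ℕ}
    (hB : B + reg.card = Fintype.card 𝒲) (c : Param p) :
    ((reg.card : ℝ) - B) * ‖z - c‖ ≤ 2 * ∑ ω ∈ reg, ‖v ω - c‖ + ε := by
  classical
  have hinf : (⨅ u : Param p, ∑ ω, ‖u - v ω‖) ≤ ∑ ω, ‖c - v ω‖ :=
    ciInf_le ⟨0, by rintro _ ⟨u, rfl⟩; positivity⟩ c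
  have h1 : ∑ ω, ‖z - v ω‖ ≤ ∑ ω, ‖c - v ω‖ + ε := by
    have := hz; unfold IsApproxGeomMedian at this; linarith
  rw [← Finset.sum_add_sum_compl reg, ← Finset.sum_add_sum_compl reg (fun ω => ‖c - v ω‖)] at h1
  -- Moving from `c` to `z` costs each regular term at least `‖z - c‖ - 2‖v ω - c‖` and gains at
  -- most `‖z - c‖` on each Byzantine term. The unknown Byzantine distances cancel between the two
  -- sides.
  have hreg : (reg.card : ℝ) * ‖z - c‖ - ∑ ω ∈ reg, ‖v ω - c‖ ≤ ∑ ω ∈ reg, ‖z - v ω‖ := by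
    rw [← nsmul_eq_mul, ← Finset.sum_const, ← Finset.sum_sub_distrib]
    refine Finset.sum_le_sum fun ω _ => ?_
    have := norm_add_le (z - v ω) (v ω - c)
    rw [sub_add_sub_cancel] at this
    linarith
  have hbyz : ∑ ω ∈ regᶜ, ‖c - v ω‖ - (B : ℝ) * ‖z - c‖ ≤ ∑ ω ∈ regᶜ, ‖z - v ω‖ := by
    have hcard : regᶜ.card = B := by rw [Finset.card_compl]; omega
    rw [← hcard, ← nsmul_eq_mul, ← Finset.sum_const, ← Finset.sum_sub_distrib]
    refine Finset.sum_le_sum fun ω _ => ?_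
    have := norm_add_le (c - z) (z - v ω)
    rw [sub_add_sub_cancel, norm_sub_rev c z] at this
    linarith
  have hcomm : ∑ ω ∈ reg, ‖c - v ω‖ = ∑ ω ∈ reg, ‖v ω - c‖ :=
    Finset.sum_congr rfl fun ω _ => norm_sub_rev _ _
  linarith

/-- Division of the linear bound by `R - B = W - 2B` produces the factor `2R/(W - 2B)`, which is
`C_α`. Squaring with `(a+b)² ≤ 2a² + 2b²` and Jensen for the average gives second moments, which are
compatible with unbiased compression. -/
theorem IsApproxGeomMedian.norm_sub_sq_le {ε : ℝ} {v : 𝒲 → Param p} {z : Param p}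
    (hz : IsApproxGeomMedian ε v z) (reg : Finset 𝒲) {W B : ℕ} (hW : W = Fintype.card 𝒲)
    (hB : B + reg.card = W) (hBW : (B : ℝ) < W / 2) (c : Param p) :
    ‖z - c‖ ^ 2 ≤ 2 * (Calpha W B ^ 2 * ((1 / (reg.card : ℝ)) * ∑ ω ∈ reg, ‖v ω - c‖ ^ 2))
      + 2 * ε ^ 2 / ((W : ℝ) - 2 * B) ^ 2 := by
  have h1 := hz.card_mul_norm_sub_le reg (hB.trans hW) c
  have hWR : (B : ℝ) + reg.card = W := by exact_mod_cast hB
  have hd : 0 < (W : ℝ) - 2 * B := by linarith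
  have hB0 : (0 : ℝ) ≤ B := by positivity
  have hR : 0 < (reg.card : ℝ) := by linarith
  have hW0 : (0 : ℝ) < W := by linarith
  have hC : Calpha W B = 2 * reg.card / ((W : ℝ) - 2 * B) := by
    have : 1 - 2 * ((B : ℝ) / W) = (W - 2 * B) / W := by field_simp
    unfold Calpha
    rw [this, ← hWR]
    have hd' : (B : ℝ) + reg.card - 2 * B ≠ 0 := by rw [hWR]; exact hd.ne'
    have hW' : (B : ℝ) + reg.card ≠ 0 := by rw [hWR]; exact hW0.ne'
    field_simp
    ring
  have h2 : ‖z - c‖ ≤ Calpha W B * ((1 / (reg.card : ℝ)) * ∑ ω ∈ reg, ‖v ω - c‖)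
      + ε / ((W : ℝ) - 2 * B) := by
    have : Calpha W B * ((1 / (reg.card : ℝ)) * ∑ ω ∈ reg, ‖v ω - c‖) + ε / ((W : ℝ) - 2 * B)
        = (2 * ∑ ω ∈ reg, ‖v ω - c‖ + ε) / ((W : ℝ) - 2 * B) := by
      rw [hC]; field_simp
    rw [this, le_div_iff₀ hd]
    have : (reg.card : ℝ) - B = W - 2 * B := by linarith
    rw [this] at h1
    linarith
  have h3 := sq_average_le reg (fun ω => ‖v ω - c‖)
  have h4 := mul_le_mul_of_nonneg_left h3 (sq_nonneg (Calpha W B))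
  have h5 : ‖z - c‖ ^ 2 ≤ (Calpha W B * ((1 / (reg.card : ℝ)) * ∑ ω ∈ reg, ‖v ω - c‖)
      + ε / ((W : ℝ) - 2 * B)) ^ 2 := by gcongr
  have h6 := add_sq_le (a := Calpha W B * ((1 / (reg.card : ℝ)) * ∑ ω ∈ reg, ‖v ω - c‖))
    (b := ε / ((W : ℝ) - 2 * B))
  rw [mul_pow (Calpha W B), div_pow] at h6
  have h7 : 2 * ε ^ 2 / ((W : ℝ) - 2 * B) ^ 2 = 2 * (ε ^ 2 / ((W : ℝ) - 2 * B) ^ 2) := by ring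
  linarith

theorem two_le_Calpha {W B : ℕ} (hBW : (B : ℝ) < W / 2) : 2 ≤ Calpha W B := by
  have hB0 : (0 : ℝ) ≤ B := by positivity
  have hW0 : (0 : ℝ) < W := by linarith
  have h1 : (B : ℝ) / W < 1 / 2 := by rw [div_lt_iff₀ hW0]; linarith
  have h2 : 0 ≤ (B : ℝ) / W := by positivity
  unfold Calpha
  rw [le_div_iff₀ (by linarith)]
  linarith

end GeometricMedian

/-! ### Gradients of the averaged costs and the inexact gradient step -/

section Gradients

variable {𝒲 : Type*} {p J : ℕ} {f : 𝒲 → Fin J → Param p → ℝ} {reg : Finset 𝒲} {μ L : ℝ}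

theorem hasGradientAt_const_mul_sum {ι : Type*} (s : Finset ι) (c : ℝ) {g : ι → Param p → ℝ}
    {g' : ι → Param p} {x : Param p} (hg : ∀ j ∈ s, HasGradientAt (g j) (g' j) x) :
    HasGradientAt (fun y => c * ∑ j ∈ s, g j y) (c • ∑ j ∈ s, g' j) x := by
  rw [hasGradientAt_iff_hasFDerivAt]
  have := (HasFDerivAt.fun_sum fun j hj => (hg j hj).hasFDerivAt).const_mul c
  have h : (InnerProductSpace.toDual ℝ (Param p)) (c • ∑ j ∈ s, g' j)
      = c • ∑ j ∈ s, (InnerProductSpace.toDual ℝ (Param p)) (g' j) := by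
    rw [map_smulₛₗ, map_sum]; rfl
  rw [h]
  exact this

theorem StronglyConvexAndSmooth.hasGradientAt_localCost (hf : StronglyConvexAndSmooth f reg μ L)
    {ω : 𝒲} (hω : ω ∈ reg) (x : Param p) :
    HasGradientAt (localCost f ω) ((1 / (J : ℝ)) • ∑ j, gradient (f ω j) x) x :=
  hasGradientAt_const_mul_sum Finset.univ _
    fun j _ => (hf.differentiable ω hω j x).hasGradientAt

theorem StronglyConvexAndSmooth.hasGradientAt_globalCost (hf : StronglyConvexAndSmooth f reg μ L)
    (x : Param p) : HasGradientAt (globalCost f reg)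
      ((1 / (reg.card : ℝ)) • ∑ ω ∈ reg, gradient (localCost f ω) x) x :=
  hasGradientAt_const_mul_sum reg _ fun ω hω => by
    have h := hf.hasGradientAt_localCost hω x
    rw [h.gradient]; exact h

theorem norm_smul_sum_sub_le {ι : Type*} (s : Finset ι) (hs : 0 < s.card) (u v : ι → Param p)
    {b : ℝ} (h : ∀ j ∈ s, ‖u j - v j‖ ≤ b) :
    ‖(1 / (s.card : ℝ)) • ∑ j ∈ s, u j - (1 / (s.card : ℝ)) • ∑ j ∈ s, v j‖ ≤ b := by
  rw [← smul_sub, ← Finset.sum_sub_distrib, norm_smul, Real.norm_of_nonneg (by positivity)]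
  refine le_trans ?_ (average_le_of_forall_le hs h)
  gcongr
  exact norm_sum_le _ _

theorem StronglyConvexAndSmooth.norm_gradient_localCost_sub_le
    (hf : StronglyConvexAndSmooth f reg μ L) (hJ : 0 < J) {ω : 𝒲} (hω : ω ∈ reg) (x y : Param p) :
    ‖gradient (localCost f ω) x - gradient (localCost f ω) y‖ ≤ L * ‖x - y‖ := by
  rw [(hf.hasGradientAt_localCost hω x).gradient, (hf.hasGradientAt_localCost hω y).gradient]
  have := norm_smul_sum_sub_le (Finset.univ : Finset (Fin J)) (by simpa using hJ)
    (fun j => gradient (f ω j) x) (fun j => gradient (f ω j) y)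
    (fun j _ => hf.lipschitz ω hω j x y)
  simpa using this

theorem StronglyConvexAndSmooth.norm_gradient_globalCost_sub_le
    (hf : StronglyConvexAndSmooth f reg μ L) (hJ : 0 < J) (hR : 0 < reg.card) (x y : Param p) :
    ‖gradient (globalCost f reg) x - gradient (globalCost f reg) y‖ ≤ L * ‖x - y‖ := by
  rw [(hf.hasGradientAt_globalCost x).gradient, (hf.hasGradientAt_globalCost y).gradient]
  exact norm_smul_sum_sub_le reg hR _ _
    (fun ω hω => hf.norm_gradient_localCost_sub_le hJ hω x y)

theorem gradient_globalCost_minimizer_eq_zero {y : Param p}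
    (hy : ∀ x, globalCost f reg y ≤ globalCost f reg x) :
    gradient (globalCost f reg) y = 0 := by
  have h1 : IsLocalMin (globalCost f reg) y := Filter.Eventually.of_forall hy
  have h2 := h1.fderiv_eq_zero
  unfold gradient
  rw [h2, map_zero]

/-- Strong monotonicity: the sum of the strong convexity inequalities at `(x, y)` and `(y, x)`, in
which the function values cancel. -/
theorem StronglyConvexAndSmooth.inner_gradient_sub_ge
    (hf : StronglyConvexAndSmooth f reg μ L) (x y : Param p) :
    μ * ‖x - y‖ ^ 2
      ≤ inner ℝ (gradient (globalCost f reg) x - gradient (globalCost f reg) y) (x - y) := by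
  have h1 := hf.strongly_convex x y
  have h2 := hf.strongly_convex y x
  rw [← neg_sub x y, inner_neg_right, norm_neg] at h2
  rw [inner_sub_left]
  linarith

/-- Strong monotonicity and Cauchy–Schwarz squeeze `μ‖x‖² ≤ L‖x‖²`. A nonzero `x` exists only in
positive dimension, which is where `1 ≤ p` is needed. -/
theorem StronglyConvexAndSmooth.modulus_le_lipschitz (hf : StronglyConvexAndSmooth f reg μ L)
    (hp : 1 ≤ p) (hJ : 0 < J) (hR : 0 < reg.card) : μ ≤ L := by
  obtain ⟨x, hx⟩ : ∃ x : Param p, x ≠ 0 := by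
    refine ⟨EuclideanSpace.single ⟨0, hp⟩ 1, fun h => ?_⟩
    have := congrArg (fun u : Param p => ‖u‖) h
    simp at this
  have hpos : 0 < ‖x - 0‖ ^ 2 := by rw [sub_zero]; have := norm_pos_iff.2 hx; positivity
  have h1 := hf.inner_gradient_sub_ge x 0
  have h2 := real_inner_le_norm
    (gradient (globalCost f reg) x - gradient (globalCost f reg) 0) (x - 0)
  have h3 := mul_le_mul_of_nonneg_right (hf.norm_gradient_globalCost_sub_le hJ hR x 0)
    (norm_nonneg (x - 0))
  refine le_of_mul_le_mul_right ?_ hpos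
  calc _ ≤ _ := h1
    _ ≤ _ := h2
    _ ≤ _ := h3
    _ = _ := by ring

/-- An inexact gradient step contracts the distance to the minimizer up to the error. -/
theorem StronglyConvexAndSmooth.norm_step_sub_sq_le (hf : StronglyConvexAndSmooth f reg μ L)
    (hJ : 0 < J) (hR : 0 < reg.card) (hμ : 0 < μ) {xs : Param p}
    (hxs : ∀ y, globalCost f reg xs ≤ globalCost f reg y) {γ : ℝ} (hγ : 0 < γ)
    (hγL : 47 * (γ * L ^ 2) ≤ μ) (hγμ : 47 * (γ * μ) ≤ 1) (x z : Param p) :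
    ‖x - γ • z - xs‖ ^ 2 ≤ (1 - 46 / 47 * (γ * μ)) * ‖x - xs‖ ^ 2
      + 48 / 47 * (γ / μ) * ‖z - gradient (globalCost f reg) x‖ ^ 2 := by
  set G := gradient (globalCost f reg) x with hG
  have h0 := gradient_globalCost_minimizer_eq_zero hxs
  have h1 := hf.inner_gradient_sub_ge x xs
  have h2 := hf.norm_gradient_globalCost_sub_le hJ hR x xs
  rw [h0, sub_zero, ← hG] at h1 h2
  have h2' : ‖G‖ ^ 2 ≤ L ^ 2 * ‖x - xs‖ ^ 2 := by
    rw [← mul_pow]; gcongr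
  have hq : 0 < γ * μ := by positivity
  -- Strong monotonicity yields the decrease `2γμ`. The quadratic term `γ²‖G‖²` costs only `γμ/47`,
  -- by `hγL`.
  have h3 : ‖x - xs - γ • G‖ ^ 2 ≤ (1 - 2 * (γ * μ) + γ * μ / 47) * ‖x - xs‖ ^ 2 := by
    rw [norm_sub_sq_real, inner_smul_right, norm_smul, mul_pow, Real.norm_eq_abs, sq_abs,
      real_inner_comm]
    have h4 : γ ^ 2 * ‖G‖ ^ 2 ≤ (γ * μ / 47) * ‖x - xs‖ ^ 2 := by
      calc γ ^ 2 * ‖G‖ ^ 2 ≤ γ ^ 2 * (L ^ 2 * ‖x - xs‖ ^ 2) := by gcongr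
        _ = γ * (γ * L ^ 2) * ‖x - xs‖ ^ 2 := by ring
        _ ≤ γ * (μ / 47) * ‖x - xs‖ ^ 2 := by gcongr; linarith
        _ = _ := by ring
    have h5 := mul_le_mul_of_nonneg_left h1 hγ.le
    linarith
  -- The weight `γμ` gives up about half of the decrease `2γμ`, so that the error enters with factor
  -- `(1 + 1/(γμ)) γ² = (1 + γμ) γ/μ`, of order `γ/μ`.
  have h6 := norm_add_sq_le_weighted (x - xs - γ • G) (-(γ • (z - G))) hq
  have h7 : x - xs - γ • G + -(γ • (z - G)) = x - γ • z - xs := by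
    rw [smul_sub]; abel
  rw [h7, norm_neg, norm_smul, mul_pow, Real.norm_eq_abs, sq_abs] at h6
  have h8 : (1 + γ * μ) * ‖x - xs - γ • G‖ ^ 2 ≤ (1 - 46 / 47 * (γ * μ)) * ‖x - xs‖ ^ 2 := by
    have h9 : (1 + γ * μ) * (1 - 2 * (γ * μ) + γ * μ / 47) ≤ 1 - 46 / 47 * (γ * μ) := by
      nlinarith
    calc _ ≤ (1 + γ * μ) * ((1 - 2 * (γ * μ) + γ * μ / 47) * ‖x - xs‖ ^ 2) := by gcongr
      _ = (1 + γ * μ) * (1 - 2 * (γ * μ) + γ * μ / 47) * ‖x - xs‖ ^ 2 := by ring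
      _ ≤ _ := by gcongr
  have h10 : (1 + 1 / (γ * μ)) * (γ ^ 2 * ‖z - G‖ ^ 2) ≤ 48 / 47 * (γ / μ) * ‖z - G‖ ^ 2 := by
    have h11 : (1 + 1 / (γ * μ)) * γ ^ 2 = (1 + γ * μ) * (γ / μ) := by field_simp; ring
    rw [← mul_assoc, h11]
    gcongr
    linarith
  linarith

end Gradients

/-! ### The Lyapunov inequality for one iteration -/

set_option maxHeartbeats 1000000 in
/-- One step of the Lyapunov function: `D`, `S`, `H` are the squared distance to the minimizer,
the staleness of the tables and the size of the auxiliary vectors, `A` is the dispersion of the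
regular messages. -/
theorem lyapunov_step {J L μ δ β γ k σ e D S H A D' S' H' : ℝ}
    (hJ : 1 ≤ J) (hμ : 0 < μ) (hμL : μ ≤ L) (hδ : 0 ≤ δ) (hβ : 0 < β) (hβ1 : β ≤ 1)
    (hγ : 0 < γ) (hk : 4 ≤ k) (he : 0 ≤ e)
    (hδk : 56 * (δ * k * L ^ 2) ≤ μ ^ 2)
    (hγk : 560 * ((1 + 5 * δ) * J ^ 4 * L ^ 4 * k * γ ^ 2) ≤ β ^ 2 * μ ^ 2)
    (hγL : 47 * (J ^ 2 * (γ * L ^ 2)) ≤ β * μ)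
    (hD : 0 ≤ D) (hS : 0 ≤ S) (hH : 0 ≤ H)
    (h1 : D' ≤ (1 - 46 / 47 * (γ * μ)) * D + 48 / 47 * (γ / μ) * (2 * (k * A) + e))
    (h2 : S' ≤ (1 - 1 / (2 * J)) * S
      + 3 * J * γ ^ 2 * (2 * L ^ 2 * D + 2 * (2 * (k * A) + e)))
    (h3 : H' ≤ (1 - β) * H + β * (L ^ 2 * S + (σ ^ 2 + L ^ 2 * D)))
    (h4 : A ≤ (1 + δ) * (L ^ 2 * S) + 2 * δ * (σ ^ 2 + L ^ 2 * D + H) + σ ^ 2) :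
    D' + 5 * J * γ * k * L ^ 2 * (1 + 5 * δ) / μ * S' + 5 * δ * k * γ / (β * μ) * H'
      ≤ (1 - γ * μ / 2) * (D + 5 * J * γ * k * L ^ 2 * (1 + 5 * δ) / μ * S
          + 5 * δ * k * γ / (β * μ) * H)
        + γ * μ / 2 * (70 / (17 * μ ^ 2) * (2 * (1 + 6 * δ) * k * σ ^ 2 + e)) := by
  have hL : 0 < L := hμ.trans_le hμL
  have hk0 : 0 < k := by linarith
  have hJ0 : 0 < J := by linarith
  -- Here `k` plays the role of `C_α²` and `e` that of `2ε²/(W-2B)²`. With `w = γ/μ`, the weights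
  -- satisfy `c2 β = 5δkw` and `c1/(2J) = (5/2) k L² w (1+5δ)`; these are the amounts by which the
  -- contractions of `H` and `S` can pay.
  obtain ⟨c1, hc1⟩ : ∃ c, c = 5 * J * γ * k * L ^ 2 * (1 + 5 * δ) / μ := ⟨_, rfl⟩
  obtain ⟨c2, hc2⟩ : ∃ c, c = 5 * δ * k * γ / (β * μ) := ⟨_, rfl⟩
  obtain ⟨w, hw⟩ : ∃ c, c = γ / μ := ⟨_, rfl⟩
  rw [← hc1, ← hc2]
  rw [← hw] at h1
  have hw0 : 0 < w := by rw [hw]; positivity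
  have hγw : γ = w * μ := by rw [hw]; field_simp
  have hc10 : 0 ≤ c1 := by rw [hc1]; positivity
  have hc20 : 0 ≤ c2 := by rw [hc2]; positivity
  have hc2β : c2 * β = 5 * (δ * k) * w := by rw [hc2, hw]; field_simp
  have hc1w : c1 = 5 * J * k * L ^ 2 * (1 + 5 * δ) * w := by rw [hc1, hw]; field_simp
  -- the size of the weight of `S` against the step size
  have hx : 112 * (c1 * (J * γ ^ 2) * J ^ 2 * L ^ 2) ≤ w * μ ^ 2 := by
    have : 112 * (c1 * (J * γ ^ 2) * J ^ 2 * L ^ 2)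
        = w * (560 * ((1 + 5 * δ) * J ^ 4 * L ^ 4 * k * γ ^ 2)) := by rw [hc1w]; ring
    rw [this]
    have hb : β ^ 2 * μ ^ 2 ≤ μ ^ 2 :=
      mul_le_of_le_one_left (sq_nonneg μ) (pow_le_one₀ hβ.le hβ1)
    exact mul_le_mul_of_nonneg_left (hγk.trans hb) hw0.le
  have hy : 112 * (c1 * (J * γ ^ 2) * L ^ 2) ≤ w * μ ^ 2 := by
    refine le_trans ?_ hx
    have hle : c1 * (J * γ ^ 2) ≤ c1 * (J * γ ^ 2) * J ^ 2 :=
      le_mul_of_one_le_right (by positivity) (one_le_pow₀ hJ)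
    gcongr
  have hμL2 : μ ^ 2 ≤ L ^ 2 := by gcongr
  have hv : 112 * (c1 * (J * γ ^ 2)) ≤ w := by
    have hL2 : 0 < L ^ 2 := by positivity
    refine le_of_mul_le_mul_right ?_ hL2
    calc _ = 112 * (c1 * (J * γ ^ 2) * L ^ 2) := by ring
      _ ≤ w * μ ^ 2 := hy
      _ ≤ _ := by gcongr
  have hJγ : 47 * (J ^ 2 * (γ * μ)) ≤ β := by
    refine le_of_mul_le_mul_right ?_ hμ
    calc _ = 47 * (J ^ 2 * (γ * μ ^ 2)) := by ring
      _ ≤ 47 * (J ^ 2 * (γ * L ^ 2)) := by gcongr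
      _ ≤ _ := hγL
  have hγβ : 47 * (γ * μ) ≤ β := by
    refine le_trans ?_ hJγ
    exact mul_le_mul_of_nonneg_left
      (le_mul_of_one_le_left (by positivity) (one_le_pow₀ hJ)) (by norm_num)
  have hqw : γ * μ = w * μ ^ 2 := by rw [hγw]; ring
  -- the weight of the dispersion
  obtain ⟨a, ha⟩ : ∃ a, a = 48 / 47 * w + 6 * (c1 * (J * γ ^ 2)) := ⟨_, rfl⟩
  have ha0 : 0 ≤ a := by rw [ha]; positivity
  have haw : a ≤ 1.08 * w := by rw [ha]; linarith
  have hT : D' + c1 * S' + c2 * H' ≤ (1 - 46 / 47 * (γ * μ)) * D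
      + 6 * (c1 * (J * γ ^ 2) * L ^ 2) * D + c1 * (1 - 1 / (2 * J)) * S
      + (c2 - c2 * β) * H + c2 * β * (L ^ 2 * S + (σ ^ 2 + L ^ 2 * D))
      + a * (2 * (k * A) + e) := by
    have e2 := mul_le_mul_of_nonneg_left h2 hc10
    have e3 := mul_le_mul_of_nonneg_left h3 hc20
    have hγJ : c1 * ((1 - 1 / (2 * J)) * S
        + 3 * J * γ ^ 2 * (2 * L ^ 2 * D + 2 * (2 * (k * A) + e)))
        = c1 * (1 - 1 / (2 * J)) * S + 6 * (c1 * (J * γ ^ 2) * L ^ 2) * D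
          + 6 * (c1 * (J * γ ^ 2)) * (2 * (k * A) + e) := by ring
    rw [hγJ] at e2
    rw [ha, add_mul]
    have e4 : c2 * ((1 - β) * H + β * (L ^ 2 * S + (σ ^ 2 + L ^ 2 * D)))
        = (c2 - c2 * β) * H + c2 * β * (L ^ 2 * S + (σ ^ 2 + L ^ 2 * D)) := by ring
    rw [e4] at e3
    linear_combination h1 + e2 + e3
  have hA : a * (2 * (k * A) + e) ≤ a * (2 * (k * ((1 + δ) * (L ^ 2 * S)
      + 2 * δ * (σ ^ 2 + L ^ 2 * D + H) + σ ^ 2)) + e) := by gcongr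
  -- comparison of the coefficients
  have kD : 6 * (c1 * (J * γ ^ 2) * L ^ 2) + c2 * β * L ^ 2 + a * (4 * (δ * k * L ^ 2))
      ≤ 0.47 * (γ * μ) := by
    -- The three contributions are at most 6/112, 5/56 and 4.32/56 of `w μ²`, together below 0.47.
    have e1 : a * (4 * (δ * k * L ^ 2)) ≤ 1.08 * w * (4 * (μ ^ 2 / 56)) := by
      gcongr; linarith
    have e2 : c2 * β * L ^ 2 ≤ 5 * w * (μ ^ 2 / 56) := by
      rw [hc2β]
      calc _ = 5 * w * (δ * k * L ^ 2) := by ring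
        _ ≤ _ := by gcongr; linarith
    have : 0 ≤ w * μ ^ 2 := by positivity
    rw [hqw]
    linarith
  -- The dispersion uses at most `4.32 δkw` of the available `5δkw`; the rest covers the contraction
  -- factor `γμ/2`, since `γμ ≤ β/47`.
  have kH : a * (4 * (δ * k)) + γ * μ / 2 * c2 ≤ c2 * β := by
    have e1 : a * (4 * (δ * k)) ≤ 1.08 * w * (4 * (δ * k)) := by gcongr
    have e2 : γ * μ / 2 * c2 ≤ β / 94 * c2 :=
      mul_le_mul_of_nonneg_right (by linarith) hc20
    have : 0 ≤ δ * k * w := by positivity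
    linarith
  -- The decrease of `S` must pay for its share of `H`, for the dispersion, and for the target rate.
  -- The `1 + 5δ` in `c1` is there for the `δ` terms of the first two.
  have kS : c2 * β * L ^ 2 + a * (2 * k * (1 + δ) * L ^ 2) + γ * μ / 2 * c1
      ≤ c1 * (1 / (2 * J)) := by
    have e0 : c1 * (1 / (2 * J)) = 5 / 2 * (k * L ^ 2 * w) * (1 + 5 * δ) := by
      rw [hc1w]; field_simp
    have e1 : a * (2 * k * (1 + δ) * L ^ 2) ≤ 1.08 * w * (2 * k * (1 + δ) * L ^ 2) := by gcongr
    have e2 : γ * μ / 2 * c1 ≤ 5 / 94 * (k * L ^ 2 * w) * (1 + 5 * δ) := by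
      have : J * (γ * μ) ≤ 1 / 47 := by
        have : J ≤ J ^ 2 := le_self_pow₀ hJ two_ne_zero
        have : J * (γ * μ) ≤ J ^ 2 * (γ * μ) := by gcongr
        linarith
      calc _ = 5 / 2 * (J * (γ * μ)) * (k * L ^ 2 * w) * (1 + 5 * δ) := by rw [hc1w]; ring
        _ ≤ 5 / 2 * (1 / 47) * (k * L ^ 2 * w) * (1 + 5 * δ) := by gcongr
        _ = _ := by ring
    rw [hc2β, e0]
    have n1 : 0 ≤ k * L ^ 2 * w := by positivity
    have n2 : 0 ≤ k * L ^ 2 * w * δ := by positivity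
    linarith
  have kσ : c2 * β + a * (2 * k * (1 + 2 * δ)) ≤ 35 / 17 * w * (2 * (1 + 6 * δ) * k) := by
    have e1 : a * (2 * k * (1 + 2 * δ)) ≤ 1.08 * w * (2 * k * (1 + 2 * δ)) := by gcongr
    rw [hc2β]
    have n1 : 0 ≤ k * w := by positivity
    have n2 : 0 ≤ k * w * δ := by positivity
    linarith
  have kε : a * e ≤ 35 / 17 * w * e := by gcongr; linarith
  have hΔ : γ * μ / 2 * (70 / (17 * μ ^ 2) * (2 * (1 + 6 * δ) * k * σ ^ 2 + e))
      = 35 / 17 * w * (2 * (1 + 6 * δ) * k * σ ^ 2 + e) := by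
    rw [hw]; field_simp; ring
  rw [hΔ]
  have kD' := mul_le_mul_of_nonneg_right kD hD
  have kH' := mul_le_mul_of_nonneg_right kH hH
  have kS' := mul_le_mul_of_nonneg_right kS hS
  have kσ' := mul_le_mul_of_nonneg_right kσ (sq_nonneg σ)
  have hqD : 0 ≤ γ * μ * D := by positivity
  -- The contraction `46/47` of `D`, in units of `γμ`, covers the target rate 0.5 and the 0.47 of
  -- `kD`; the surplus is positive.
  linear_combination hT + hA + kD' + kH' + kS' + kσ' + kε + (46 / 47 - 0.5 - 0.47) * hqD

/-! ### Averaging over the draws of one iteration -/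

section ConditionalExpectation

variable {Ω : Type*} {mΩ : MeasurableSpace Ω} {P : Measure Ω} [IsProbabilityMeasure P]
  {𝒴 : Type*} [MeasurableSpace 𝒴] {J : ℕ} {S : Type*} [MeasurableSpace S]

/-- The joint law of a variable of the past, an index and a seed is the product of their laws. -/
theorem map_past_draws_eq_prod (ℱ : Filtration ℕ mΩ) (t : ℕ) {Y : Ω → 𝒴}
    (hY : Measurable[ℱ t] Y) {i : Ω → Fin J} {ξ : Ω → S} (hi : Measurable i) (hξ : Measurable ξ)
    (hpast : Indep (ℱ t) (MeasurableSpace.comap (fun a => (i a, ξ a)) inferInstance) P)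
    (hdraws : IndepFun i ξ P) :
    P.map (fun a => (Y a, (i a, ξ a))) = (P.map Y).prod ((P.map i).prod (P.map ξ)) := by
  have h1 : IndepFun Y (fun a => (i a, ξ a)) P := by
    rw [IndepFun_iff_Indep]
    exact indep_of_indep_of_le_left hpast hY.comap_le
  have hY' : Measurable Y := hY.mono (ℱ.le t) le_rfl
  rw [(indepFun_iff_map_prod_eq_prod_map_map hY'.aemeasurable
      (hi.prodMk hξ).aemeasurable).1 h1,
    (indepFun_iff_map_prod_eq_prod_map_map hi.aemeasurable hξ.aemeasurable).1 hdraws]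

/-- A bound on the mean over the draws, for every fixed past, is a bound on the expectation. -/
theorem integrable_and_integral_le_of_forall_past (ℱ : Filtration ℕ mΩ) (t : ℕ)
    {Y : Ω → 𝒴} (hY : Measurable[ℱ t] Y) {i : Ω → Fin J} {ξ : Ω → S} (hi : Measurable i)
    (hξ : Measurable ξ)
    (hpast : Indep (ℱ t) (MeasurableSpace.comap (fun a => (i a, ξ a)) inferInstance) P)
    (hdraws : IndepFun i ξ P) (hunif : ∀ j, P.real {a | i a = j} = 1 / (J : ℝ))
    {ν : Measure S} [IsProbabilityMeasure ν] (hlaw : P.map ξ = ν)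
    {G : 𝒴 → Fin J → S → ℝ} (hG : Measurable fun q : 𝒴 × Fin J × S => G q.1 q.2.1 q.2.2)
    (hG0 : ∀ y j s, 0 ≤ G y j s) (hGi : ∀ y j, Integrable (G y j) ν) {K : 𝒴 → ℝ}
    (hK : ∀ y, (1 / (J : ℝ)) * ∑ j, ∫ s, G y j s ∂ν ≤ K y)
    (hKi : Integrable (fun a => K (Y a)) P) :
    Integrable (fun a => G (Y a) (i a) (ξ a)) P ∧
      ∫ a, G (Y a) (i a) (ξ a) ∂P ≤ ∫ a, K (Y a) ∂P := by
  have hY' : Measurable Y := hY.mono (ℱ.le t) le_rfl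
  have hj : ∀ j, P.map i {j} = ENNReal.ofReal (1 / (J : ℝ)) := by
    intro j
    rw [Measure.map_apply hi (MeasurableSet.singleton j), ← hunif j, ofReal_measureReal]
    rfl
  have hK0 : ∀ y, 0 ≤ K y := fun y => le_trans (mul_nonneg (by positivity)
    (Finset.sum_nonneg fun j _ => integral_nonneg (hG0 y j))) (hK y)
  have hinner : ∀ y, ∫⁻ q : Fin J × S, ENNReal.ofReal (G y q.1 q.2) ∂((P.map i).prod ν)
      ≤ ENNReal.ofReal (K y) := by
    intro y
    have := Measure.isProbabilityMeasure_map (μ := P) hi.aemeasurable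
    have hGy : Measurable fun q : Fin J × S => G y q.1 q.2 := hG.comp measurable_prodMk_left
    rw [lintegral_prod _ hGy.ennreal_ofReal.aemeasurable,
      lintegral_fintype]
    have : ∀ j, (∫⁻ s, ENNReal.ofReal (G y j s) ∂ν) * P.map i {j}
        = ENNReal.ofReal ((1 / (J : ℝ)) * ∫ s, G y j s ∂ν) := by
      intro j
      rw [hj, ← ofReal_integral_eq_lintegral_ofReal (hGi y j)
        (Filter.Eventually.of_forall (hG0 y j)), mul_comm, ENNReal.ofReal_mul (by positivity)]
    simp only [this]
    rw [← ENNReal.ofReal_sum_of_nonneg fun j _ => mul_nonneg (by positivity)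
      (integral_nonneg (hG0 y j)), ← Finset.mul_sum]
    exact ENNReal.ofReal_le_ofReal (hK y)
  have hmeas : Measurable fun a => G (Y a) (i a) (ξ a) :=
    hG.comp (hY'.prodMk (hi.prodMk hξ))
  -- Integrability of `G` is not known in advance. Tonelli for nonnegative functions needs none, and
  -- the finite upper bound then supplies it.
  have hle : ∫⁻ a, ENNReal.ofReal (G (Y a) (i a) (ξ a)) ∂P ≤ ∫⁻ a, ENNReal.ofReal (K (Y a)) ∂P := by
    have h1 := lintegral_map (μ := P) (f := fun q : 𝒴 × Fin J × S =>
      ENNReal.ofReal (G q.1 q.2.1 q.2.2)) hG.ennreal_ofReal (hY'.prodMk (hi.prodMk hξ))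
    have := Measure.isProbabilityMeasure_map (μ := P) hi.aemeasurable
    rw [← h1, map_past_draws_eq_prod ℱ t hY hi hξ hpast hdraws, hlaw,
      lintegral_prod _ hG.ennreal_ofReal.aemeasurable,
      lintegral_map hG.ennreal_ofReal.lintegral_prod_right' hY']
    exact lintegral_mono fun a => hinner (Y a)
  have hfin := hKi.lintegral_lt_top
  have hint : Integrable (fun a => G (Y a) (i a) (ξ a)) P := by
    refine ⟨hmeas.aestronglyMeasurable, ?_⟩
    rw [hasFiniteIntegral_iff_ofReal (Filter.Eventually.of_forall fun a => hG0 _ _ _)]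
    exact hle.trans_lt hfin
  refine ⟨hint, ?_⟩
  rw [integral_eq_lintegral_of_nonneg_ae (Filter.Eventually.of_forall fun a => hG0 _ _ _)
      hmeas.aestronglyMeasurable,
    integral_eq_lintegral_of_nonneg_ae (Filter.Eventually.of_forall fun a => hK0 _)
      hKi.aestronglyMeasurable]
  exact ENNReal.toReal_mono hfin.ne hle

end ConditionalExpectation

/-! ### Second moments of the compressor -/

section Compressor

variable {S : Type*} [MeasurableSpace S] {p : ℕ} {ν : Measure S} [IsProbabilityMeasure ν]
  {Q : S → Param p → Param p} {δ : ℝ}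

theorem IsUnbiasedCompressor.integrable_norm_add_smul_sq (hQ : IsUnbiasedCompressor ν Q δ)
    (c u : Param p) (b : ℝ) : Integrable (fun s => ‖c + b • Q s u‖ ^ 2) ν := by
  have hd : MemLp (fun s => Q s u - u) 2 ν := by
    exact (memLp_two_iff_integrable_sq_norm ((hQ.integrable u).aestronglyMeasurable.sub
      aestronglyMeasurable_const)).2 (hQ.integrable_sq u)
  have h1 : MemLp (fun s => c + b • u + b • (Q s u - u)) 2 ν :=
    (memLp_const (c + b • u)).add (hd.const_smul b)
  have h2 : ∀ s, c + b • Q s u = c + b • u + b • (Q s u - u) := by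
    intro s; rw [smul_sub]; abel
  simp only [h2]
  exact (memLp_two_iff_integrable_sq_norm h1.aestronglyMeasurable).1 h1

/-- Expansion around the mean `c + b • u`: the cross term vanishes by unbiasedness, and only the
variance remains. -/
theorem IsUnbiasedCompressor.integral_norm_add_smul_sq_le (hQ : IsUnbiasedCompressor ν Q δ)
    (c u : Param p) (b : ℝ) :
    ∫ s, ‖c + b • Q s u‖ ^ 2 ∂ν ≤ ‖c + b • u‖ ^ 2 + b ^ 2 * (δ * ‖u‖ ^ 2) := by
  have hi : Integrable (fun s => Q s u - u) ν := (hQ.integrable u).sub (integrable_const u)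
  have h0 : ∫ s, (Q s u - u) ∂ν = 0 := by
    rw [integral_sub (hQ.integrable u) (integrable_const u), hQ.unbiased]; simp
  have h2 : ∀ s, ‖c + b • Q s u‖ ^ 2 = ‖c + b • u‖ ^ 2
      + 2 * b * inner ℝ (c + b • u) (Q s u - u) + b ^ 2 * ‖Q s u - u‖ ^ 2 := by
    intro s
    have : c + b • Q s u = c + b • u + b • (Q s u - u) := by rw [smul_sub]; abel
    rw [this, norm_add_sq_real, inner_smul_right, norm_smul, mul_pow, Real.norm_eq_abs, sq_abs]
    ring
  simp only [h2]
  have hinner : Integrable (fun s => 2 * b * inner ℝ (c + b • u) (Q s u - u)) ν :=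
    (hi.const_inner _).const_mul _
  have hsum : Integrable (fun s => ‖c + b • u‖ ^ 2
      + 2 * b * inner ℝ (c + b • u) (Q s u - u)) ν := (integrable_const _).add hinner
  rw [integral_add hsum ((hQ.integrable_sq u).const_mul _),
    integral_add (integrable_const _) hinner, integral_const_mul, integral_const_mul,
    integral_inner hi, h0, inner_zero_right]
  have := mul_le_mul_of_nonneg_left (hQ.variance_le u) (sq_nonneg b)
  simp
  linarith

end Compressor

/-! ### Corrected gradients and staleness of the tables -/

section Saga

variable {𝒲 : Type*} {p J : ℕ} {f : 𝒲 → Fin J → Param p → ℝ} {reg : Finset 𝒲} {μ L : ℝ}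

/-- Mean squared distance of a point from the table points of a worker. -/
noncomputable def tableStaleness (x : Param p) (φ : Fin J → Param p) : ℝ :=
  (1 / (J : ℝ)) * ∑ j, ‖x - φ j‖ ^ 2

theorem tableStaleness_nonneg (x : Param p) (φ : Fin J → Param p) : 0 ≤ tableStaleness x φ := by
  unfold tableStaleness; positivity

/-- Second moment of the corrected gradient around an arbitrary vector. -/
theorem StronglyConvexAndSmooth.average_norm_sagaGradient_sub_sq_le
    (hf : StronglyConvexAndSmooth f reg μ L) (hJ : 0 < J) {ω : 𝒲} (hω : ω ∈ reg) (x : Param p)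
    (φ : Fin J → Param p) (v : Param p) :
    (1 / (J : ℝ)) * ∑ j, ‖sagaGradient (f ω) x φ j - v‖ ^ 2
      ≤ L ^ 2 * tableStaleness x φ + ‖gradient (localCost f ω) x - v‖ ^ 2 := by
  have hcard : (Finset.univ : Finset (Fin J)).card = J := by simp
  have hpos : 0 < (Finset.univ : Finset (Fin J)).card := by simpa using hJ
  have hJ0 : (J : ℝ) ≠ 0 := by positivity
  obtain ⟨m, hm⟩ : ∃ m, m = (1 / (J : ℝ)) • ∑ j, gradient (f ω j) (φ j) := ⟨_, rfl⟩
  obtain ⟨d, hd⟩ : ∃ d : Fin J → Param p,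
    d = fun j => gradient (f ω j) x - gradient (f ω j) (φ j) := ⟨_, rfl⟩
  have hg : ∀ j, sagaGradient (f ω) x φ j = d j + m := fun j => by rw [hd, hm]; rfl
  obtain ⟨n, hn⟩ : ∃ n, n = (1 / (J : ℝ)) • ∑ j, d j := ⟨_, rfl⟩
  have hnm : n + m = gradient (localCost f ω) x := by
    rw [(hf.hasGradientAt_localCost hω x).gradient, hn, hm, hd, ← smul_add,
      ← Finset.sum_add_distrib]
    simp
  have hmean : (1 / ((Finset.univ : Finset (Fin J)).card : ℝ)) • ∑ j, (d j + m) = n + m := by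
    rw [hcard, Finset.sum_add_distrib, smul_add, ← hn, Finset.sum_const, hcard,
      ← Nat.cast_smul_eq_nsmul ℝ, smul_smul, one_div_mul_cancel hJ0, one_smul]
  -- Over a uniform index the corrected gradient has mean `∇f_ω(x)`, which isolates the squared bias
  -- around `v`. Its variance is that of the differences `d j`, hence at most their second moment,
  -- and Lipschitz continuity turns this into staleness.
  have h1 := average_norm_sub_sq Finset.univ hpos (fun j => d j + m) (n + m) v hmean
  have h2 := average_norm_sub_sq_le Finset.univ hpos d n 0 (by rw [hcard, hn])
  simp only [hcard, add_sub_add_right_eq_sub, sub_zero] at h1 h2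
  simp only [hg]
  rw [h1, hnm]
  have h3 : (1 / (J : ℝ)) * ∑ j, ‖d j‖ ^ 2 ≤ L ^ 2 * tableStaleness x φ := by
    have : L ^ 2 * tableStaleness x φ = (1 / (J : ℝ)) * ∑ j, L ^ 2 * ‖x - φ j‖ ^ 2 := by
      rw [tableStaleness, ← Finset.mul_sum]; ring
    rw [this]
    gcongr with j
    rw [← mul_pow, hd]
    have := hf.lipschitz ω hω j x (φ j)
    gcongr
  linarith

variable {S : Type*} [MeasurableSpace S] {ν : Measure S} [IsProbabilityMeasure ν]
  {Q : S → Param p → Param p} {δ : ℝ}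

/-- Second moment, around `v`, of the vector reconstructed by the master. -/
theorem StronglyConvexAndSmooth.moment_reconstruction_le
    (hf : StronglyConvexAndSmooth f reg μ L) (hJ : 0 < J) (hQ : IsUnbiasedCompressor ν Q δ)
    {ω : 𝒲} (hω : ω ∈ reg) (x : Param p) (φ : Fin J → Param p) (h v : Param p) :
    (1 / (J : ℝ)) * ∑ j, ∫ s, ‖h + Q s (sagaGradient (f ω) x φ j - h) - v‖ ^ 2 ∂ν
      ≤ (1 + δ) * (L ^ 2 * tableStaleness x φ) + δ * ‖gradient (localCost f ω) x - h‖ ^ 2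
        + ‖gradient (localCost f ω) x - v‖ ^ 2 := by
  have h1 : ∀ j, ∫ s, ‖h + Q s (sagaGradient (f ω) x φ j - h) - v‖ ^ 2 ∂ν
      ≤ ‖sagaGradient (f ω) x φ j - v‖ ^ 2 + δ * ‖sagaGradient (f ω) x φ j - h‖ ^ 2 := by
    intro j
    have := hQ.integral_norm_add_smul_sq_le (h - v) (sagaGradient (f ω) x φ j - h) 1
    simp only [one_smul, one_pow, one_mul] at this
    have e1 : h - v + (sagaGradient (f ω) x φ j - h) = sagaGradient (f ω) x φ j - v := by abel
    rw [e1] at this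
    simpa only [sub_add_eq_add_sub] using this
  have h2 := hf.average_norm_sagaGradient_sub_sq_le hJ hω x φ v
  have h3 := mul_le_mul_of_nonneg_left
    (hf.average_norm_sagaGradient_sub_sq_le hJ hω x φ h) hQ.nonneg
  calc _ ≤ (1 / (J : ℝ)) * ∑ j, (‖sagaGradient (f ω) x φ j - v‖ ^ 2
        + δ * ‖sagaGradient (f ω) x φ j - h‖ ^ 2) := by gcongr; exact h1 _
    _ = (1 / (J : ℝ)) * ∑ j, ‖sagaGradient (f ω) x φ j - v‖ ^ 2
        + δ * ((1 / (J : ℝ)) * ∑ j, ‖sagaGradient (f ω) x φ j - h‖ ^ 2) := by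
      rw [Finset.sum_add_distrib, ← Finset.mul_sum]; ring
    _ ≤ _ := by linarith

/-- Second moment of the updated auxiliary vector. -/
theorem StronglyConvexAndSmooth.moment_auxiliary_le
    (hf : StronglyConvexAndSmooth f reg μ L) (hJ : 0 < J) (hQ : IsUnbiasedCompressor ν Q δ)
    {β : ℝ} (hβ0 : 0 ≤ β) (hβ : β * (1 + δ) ≤ 1)
    {ω : 𝒲} (hω : ω ∈ reg) (x : Param p) (φ : Fin J → Param p) (h : Param p) :
    (1 / (J : ℝ)) * ∑ j, ∫ s, ‖h + β • Q s (sagaGradient (f ω) x φ j - h)‖ ^ 2 ∂ν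
      ≤ (1 - β) * ‖h‖ ^ 2
        + β * (L ^ 2 * tableStaleness x φ + ‖gradient (localCost f ω) x‖ ^ 2) := by
  have hJ0 : (J : ℝ) ≠ 0 := by positivity
  have h1 : ∀ j, ∫ s, ‖h + β • Q s (sagaGradient (f ω) x φ j - h)‖ ^ 2 ∂ν
      ≤ (1 - β) * ‖h‖ ^ 2 + β * ‖sagaGradient (f ω) x φ j - 0‖ ^ 2 := by
    intro j
    refine (hQ.integral_norm_add_smul_sq_le h (sagaGradient (f ω) x φ j - h) β).trans ?_
    obtain ⟨u, hu⟩ : ∃ u, u = sagaGradient (f ω) x φ j - h := ⟨_, rfl⟩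
    have e1 : sagaGradient (f ω) x φ j = h + u := by rw [hu]; abel
    rw [← hu, e1, sub_zero, norm_add_sq_real, norm_add_sq_real, inner_smul_right, norm_smul,
      mul_pow, Real.norm_eq_abs, sq_abs]
    -- Both sides expand to `‖h‖² + 2β⟨h,u⟩` plus a multiple of `‖u‖²`; only `β²(1+δ) ≤ β` is left
    -- to compare.
    have e2 : β * (β * (1 + δ)) * ‖u‖ ^ 2 ≤ β * 1 * ‖u‖ ^ 2 := by gcongr
    linarith
  have h2 := mul_le_mul_of_nonneg_left
    (hf.average_norm_sagaGradient_sub_sq_le hJ hω x φ 0) hβ0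
  calc _ ≤ (1 / (J : ℝ)) * ∑ j, ((1 - β) * ‖h‖ ^ 2
        + β * ‖sagaGradient (f ω) x φ j - 0‖ ^ 2) := by gcongr; exact h1 _
    _ = (1 - β) * ‖h‖ ^ 2
        + β * ((1 / (J : ℝ)) * ∑ j, ‖sagaGradient (f ω) x φ j - 0‖ ^ 2) := by
      rw [Finset.sum_add_distrib, ← Finset.mul_sum, Finset.sum_const, Finset.card_univ,
        Fintype.card_fin, nsmul_eq_mul, ← Finset.mul_sum]
      field_simp
    _ ≤ _ := by rw [sub_zero] at h2; linarith

/-- Refreshing a uniformly chosen table point contracts the staleness. -/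
theorem average_tableStaleness_update (hJ : 0 < J) (x : Param p) (φ : Fin J → Param p) :
    (1 / (J : ℝ)) * ∑ i, tableStaleness x (fun j => if j = i then x else φ j)
      = (1 - 1 / (J : ℝ)) * tableStaleness x φ := by
  have hJ0 : (J : ℝ) ≠ 0 := by positivity
  have h1 : ∀ i, ∑ j, ‖x - (if j = i then x else φ j)‖ ^ 2
      = ∑ j, ‖x - φ j‖ ^ 2 - ‖x - φ i‖ ^ 2 := by
    intro i
    rw [eq_sub_iff_add_eq, ← Finset.sum_erase_add _ _ (Finset.mem_univ i),
      ← Finset.sum_erase_add _ (fun j => ‖x - φ j‖ ^ 2) (Finset.mem_univ i)]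
    simp only [if_true, sub_self, norm_zero]
    have : ∀ j ∈ Finset.univ.erase i, ‖x - (if j = i then x else φ j)‖ ^ 2 = ‖x - φ j‖ ^ 2 := by
      intro j hj
      rw [if_neg (Finset.ne_of_mem_erase hj)]
    rw [Finset.sum_congr rfl this]
    ring
  unfold tableStaleness
  simp only [h1, ← Finset.mul_sum, Finset.sum_sub_distrib, Finset.sum_const, Finset.card_univ,
    Fintype.card_fin, nsmul_eq_mul]
  field_simp

/-- Staleness after a step and a refresh of the table. -/
theorem tableStaleness_step_le (hJ : 0 < J) (x w : Param p) (φ : Fin J → Param p) :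
    tableStaleness (x - w) φ
      ≤ (1 + 1 / (2 * (J : ℝ))) * tableStaleness x φ + (1 + 2 * (J : ℝ)) * ‖w‖ ^ 2 := by
  have hJ0 : (0 : ℝ) < J := by exact_mod_cast hJ
  have h1 : ∀ j, ‖x - w - φ j‖ ^ 2
      ≤ (1 + 1 / (2 * (J : ℝ))) * ‖x - φ j‖ ^ 2 + (1 + 2 * (J : ℝ)) * ‖w‖ ^ 2 := by
    intro j
    -- The weight `1/(2J)` spends half of the contraction `1/J` that a refresh provides.
    have := norm_add_sq_le_weighted (x - φ j) (-w) (s := 1 / (2 * (J : ℝ))) (by positivity)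
    rw [norm_neg, one_div_one_div] at this
    have e1 : x - w - φ j = x - φ j + -w := by abel
    rwa [e1]
  calc _ ≤ (1 / (J : ℝ)) * ∑ j, ((1 + 1 / (2 * (J : ℝ))) * ‖x - φ j‖ ^ 2
        + (1 + 2 * (J : ℝ)) * ‖w‖ ^ 2) := by
        unfold tableStaleness; gcongr; exact h1 _
    _ = _ := by
      rw [Finset.sum_add_distrib, ← Finset.mul_sum, Finset.sum_const, Finset.card_univ,
        Fintype.card_fin, nsmul_eq_mul, tableStaleness]
      field_simp

end Saga

/-! ### Measurability, moments and recursive estimates along a run -/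

section Run

variable {𝒲 : Type*} {p J : ℕ} {f : 𝒲 → Fin J → Param p → ℝ} {reg : Finset 𝒲} {μ L : ℝ}

/-- The regular local gradients have second moment at most `σ² + L²‖u - x*‖²` on average. -/
theorem StronglyConvexAndSmooth.average_norm_gradient_sq_le
    (hf : StronglyConvexAndSmooth f reg μ L) (hJ : 0 < J) (hR : 0 < reg.card) {σ : ℝ}
    (hσ : BoundedOuterVariation f reg σ) {xs : Param p}
    (hxs : ∀ y, globalCost f reg xs ≤ globalCost f reg y) (u : Param p) :
    (1 / (reg.card : ℝ)) * ∑ ω ∈ reg, ‖gradient (localCost f ω) u‖ ^ 2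
      ≤ σ ^ 2 + L ^ 2 * ‖u - xs‖ ^ 2 := by
  -- Second moment equals variance plus squared mean: the variance is the outer variation, and the
  -- mean is `∇f(u)`, which vanishes at the minimizer.
  have h1 := average_norm_sub_sq reg hR (fun ω => gradient (localCost f ω) u)
    (gradient (globalCost f reg) u) 0 (hf.hasGradientAt_globalCost u).gradient.symm
  have h2 := hf.norm_gradient_globalCost_sub_le hJ hR u xs
  rw [gradient_globalCost_minimizer_eq_zero hxs] at h2
  have h3 : ‖gradient (globalCost f reg) u - 0‖ ^ 2 ≤ L ^ 2 * ‖u - xs‖ ^ 2 := by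
    rw [← mul_pow]; gcongr
  simp only [sub_zero] at h1 h3
  rw [h1]
  linarith [hσ u]

theorem integral_average_le {Ω : Type*} {mΩ : MeasurableSpace Ω} {P : Measure Ω}
    {s : Finset 𝒲} {F K : 𝒲 → Ω → ℝ}
    (hF : ∀ ω ∈ s, Integrable (F ω) P ∧ ∫ a, F ω a ∂P ≤ ∫ a, K ω a ∂P)
    (hK : ∀ ω ∈ s, Integrable (K ω) P) :
    ∫ a, (1 / (s.card : ℝ)) * ∑ ω ∈ s, F ω a ∂P ≤ ∫ a, (1 / (s.card : ℝ)) * ∑ ω ∈ s, K ω a ∂P := by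
  rw [integral_const_mul, integral_const_mul, integral_finsetSum _ fun ω hω => (hF ω hω).1,
    integral_finsetSum _ hK]
  exact average_mono fun ω hω => (hF ω hω).2

theorem integrable_average {Ω : Type*} {mΩ : MeasurableSpace Ω} {P : Measure Ω}
    {s : Finset 𝒲} {F : 𝒲 → Ω → ℝ} (hF : ∀ ω ∈ s, Integrable (F ω) P) :
    Integrable (fun a => (1 / (s.card : ℝ)) * ∑ ω ∈ s, F ω a) P :=
  (integrable_finsetSum _ hF).const_mul _

theorem continuous_of_norm_sub_le {E : Type*} [NormedAddCommGroup E] {g : E → E} {L : ℝ}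
    (hg : ∀ x y, ‖g x - g y‖ ≤ L * ‖x - y‖) : Continuous g := by
  refine (LipschitzWith.of_dist_le_mul (K := L.toNNReal) fun x y => ?_).continuous
  rw [dist_eq_norm, dist_eq_norm]
  refine (hg x y).trans ?_
  gcongr
  exact Real.le_coe_toNNReal L

theorem memLp_comp_of_norm_sub_le {Ω : Type*} {mΩ : MeasurableSpace Ω} {P : Measure Ω}
    [IsProbabilityMeasure P] {g : Param p → Param p} {L : ℝ}
    (hg : ∀ x y, ‖g x - g y‖ ≤ L * ‖x - y‖) {X : Ω → Param p} (hX : MemLp X 2 P) :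
    MemLp (fun a => g (X a)) 2 P := by
  have h1 : MemLp (fun a => g (X a) - g 0) 2 P := by
    refine MemLp.of_le_mul (c := L) hX ?_ (Filter.Eventually.of_forall fun a => ?_)
    · exact ((continuous_of_norm_sub_le hg).comp_aestronglyMeasurable
        hX.aestronglyMeasurable).sub aestronglyMeasurable_const
    · simpa using hg (X a) 0
  have h2 := h1.add (memLp_const (g 0))
  refine h2.congr_norm ?_ (Filter.Eventually.of_forall fun a => by simp)
  exact (continuous_of_norm_sub_le hg).comp_aestronglyMeasurable hX.aestronglyMeasurable

theorem StronglyConvexAndSmooth.measurable_sagaGradient (hf : StronglyConvexAndSmooth f reg μ L)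
    {ω : 𝒲} (hω : ω ∈ reg) :
    Measurable fun q : (Param p × (Fin J → Param p)) × Fin J =>
      sagaGradient (f ω) q.1.1 q.1.2 q.2 := by
  have hc : ∀ j, Measurable (gradient (f ω j)) := fun j =>
    (continuous_of_norm_sub_le (hf.lipschitz ω hω j)).measurable
  refine measurable_from_prod_countable_left fun j => ?_
  have h1 : Measurable fun q : Param p × (Fin J → Param p) => gradient (f ω j) q.1 :=
    (hc j).comp measurable_fst
  have h2 : ∀ k, Measurable fun q : Param p × (Fin J → Param p) => gradient (f ω k) (q.2 k) :=
    fun k => (hc k).comp ((measurable_pi_apply k).comp measurable_snd)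
  have h3 : Measurable fun q : Param p × (Fin J → Param p) => ∑ k, gradient (f ω k) (q.2 k) :=
    Finset.measurable_fun_sum _ fun k _ => h2 k
  exact (h1.sub (h2 j)).add (h3.const_smul (1 / (J : ℝ)))

theorem StronglyConvexAndSmooth.measurable_message (hf : StronglyConvexAndSmooth f reg μ L)
    {S : Type*} [MeasurableSpace S] {ν : Measure S} {Q : S → Param p → Param p} {δ : ℝ}
    (hQ : IsUnbiasedCompressor ν Q δ) {ω : 𝒲} (hω : ω ∈ reg) {A : Type*} {mA : MeasurableSpace A}
    {u w : A → Param p} {v : A → Fin J → Param p} {j : A → Fin J} {s : A → S}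
    (hu : Measurable u) (hv : Measurable v) (hw : Measurable w) (hj : Measurable j)
    (hs : Measurable s) :
    Measurable fun a => Q (s a) (sagaGradient (f ω) (u a) (v a) (j a) - w a) := by
  have h1 : Measurable fun a => sagaGradient (f ω) (u a) (v a) (j a) :=
    Measurable.comp (g := fun q : (Param p × (Fin J → Param p)) × Fin J =>
      sagaGradient (f ω) q.1.1 q.1.2 q.2) (f := fun a => ((u a, v a), j a))
      (hf.measurable_sagaGradient hω) ((hu.prodMk hv).prodMk hj)
  have h2 : Measurable fun a => (s a, sagaGradient (f ω) (u a) (v a) (j a) - w a) :=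
    hs.prodMk (h1.sub hw)
  exact Measurable.comp (g := fun q : S × Param p => Q q.1 q.2) hQ.measurable h2

theorem measurable_table {A : Type*} {mA : MeasurableSpace A} {v : Fin J → A → Param p}
    (hv : ∀ j, Measurable (v j)) : Measurable fun a j => v j a :=
  measurable_pi_lambda _ hv

theorem measurable_tableStaleness :
    Measurable fun q : Param p × (Fin J → Param p) => tableStaleness q.1 q.2 := by
  unfold tableStaleness
  fun_prop

theorem measurable_tableStaleness_comp {A : Type*} {mA : MeasurableSpace A} {u : A → Param p}
    {v : A → Fin J → Param p} (hu : Measurable u) (hv : Measurable v) :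
    Measurable fun a => tableStaleness (u a) (v a) :=
  Measurable.comp (g := fun q : Param p × (Fin J → Param p) => tableStaleness q.1 q.2)
    (f := fun a => (u a, v a)) measurable_tableStaleness (hu.prodMk hv)

theorem measurable_refresh {A : Type*} {mA : MeasurableSpace A} {u v : A → Param p}
    {i : A → Fin J} (hu : Measurable u) (hv : Measurable v) (hi : Measurable i) (j : Fin J) :
    Measurable fun a => if j = i a then u a else v a :=
  Measurable.ite (measurableSet_eq_fun measurable_const hi) hu hv

theorem measurable_tableStaleness_refresh {A : Type*} {mA : MeasurableSpace A} {u : A → Param p}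
    {v : A → Fin J → Param p} {i : A → Fin J} (hu : Measurable u) (hv : Measurable v)
    (hi : Measurable i) :
    Measurable fun a => tableStaleness (u a) (fun j => if j = i a then u a else v a j) := by
  have h1 : ∀ j, Measurable fun a => v a j := fun j =>
    Measurable.comp (g := fun w : Fin J → Param p => w j) (measurable_pi_apply j) hv
  have h2 : Measurable fun a => fun j => if j = i a then u a else v a j :=
    measurable_table (v := fun j a => if j = i a then u a else v a j)
      fun j => measurable_refresh hu (h1 j) hi j
  exact measurable_tableStaleness_comp hu h2

variable {S : Type*} [MeasurableSpace S]

theorem measurable_state_x : Measurable fun q :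
    (Param p × (Fin J → Param p) × Param p) × Fin J × S => q.1.1 :=
  measurable_fst.comp measurable_fst

theorem measurable_state_φ : Measurable fun q :
    (Param p × (Fin J → Param p) × Param p) × Fin J × S => q.1.2.1 :=
  measurable_fst.comp (measurable_snd.comp measurable_fst)

theorem measurable_state_h : Measurable fun q :
    (Param p × (Fin J → Param p) × Param p) × Fin J × S => q.1.2.2 :=
  measurable_snd.comp (measurable_snd.comp measurable_fst)

theorem measurable_state_index : Measurable fun q :
    (Param p × (Fin J → Param p) × Param p) × Fin J × S => q.2.1 :=
  measurable_fst.comp measurable_snd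

theorem measurable_state_seed : Measurable fun q :
    (Param p × (Fin J → Param p) × Param p) × Fin J × S => q.2.2 :=
  measurable_snd.comp measurable_snd

variable {Ω : Type*} {mΩ : MeasurableSpace Ω} {P : Measure Ω}
  {ℱ : Filtration ℕ mΩ} [Fintype 𝒲]
  {ν : Measure S}
  {Q : S → Param p → Param p} {δ γ β ε : ℝ} {x₀ : Param p} {h₀ : 𝒲 → Param p}
  {x : ℕ → Ω → Param p} {φ : ℕ → 𝒲 → Fin J → Ω → Param p} {h : ℕ → 𝒲 → Ω → Param p}
  {i : ℕ → 𝒲 → Ω → Fin J} {ξ : ℕ → 𝒲 → Ω → S} {m : ℕ → 𝒲 → Ω → Param p} {z : ℕ → Ω → Param p}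

/-- Adaptedness, here and for `φ` and `h`, is what makes the state at time `t` independent of the
draws of iteration `t`. -/
theorem IsBroadcastRun.measurable_x
    (hrun : IsBroadcastRun P ℱ reg f ν Q γ β ε x₀ h₀ x φ h i ξ m z) (t : ℕ) :
    Measurable[ℱ t] (x t) := by
  induction t with
  | zero =>
    have : x 0 = fun _ => x₀ := funext hrun.x_zero
    rw [this]; exact measurable_const
  | succ t ih =>
    have : x (t + 1) = fun a => x t a - γ • z t a := funext (hrun.x_succ t)
    rw [this]
    exact (ih.mono (ℱ.mono t.le_succ) le_rfl).sub ((hrun.z_measurable t).const_smul γ)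

theorem IsBroadcastRun.measurable_φ
    (hrun : IsBroadcastRun P ℱ reg f ν Q γ β ε x₀ h₀ x φ h i ξ m z) {ω : 𝒲} (hω : ω ∈ reg)
    (j : Fin J) (t : ℕ) : Measurable[ℱ t] (φ t ω j) := by
  induction t with
  | zero =>
    have : φ 0 ω j = fun _ => x₀ := funext (hrun.φ_zero ω hω j)
    rw [this]; exact measurable_const
  | succ t ih =>
    have : φ (t + 1) ω j = fun a => if j = i t ω a then x t a else φ t ω j a :=
      funext (hrun.φ_succ t ω hω j)
    rw [this]
    exact measurable_refresh ((hrun.measurable_x t).mono (ℱ.mono t.le_succ) le_rfl)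
      (ih.mono (ℱ.mono t.le_succ) le_rfl) (hrun.i_measurable t ω hω) j

theorem IsBroadcastRun.measurable_table
    (hrun : IsBroadcastRun P ℱ reg f ν Q γ β ε x₀ h₀ x φ h i ξ m z) {ω : 𝒲} (hω : ω ∈ reg)
    (t : ℕ) : Measurable[ℱ t] (fun a j => φ t ω j a) :=
  _root_.measurable_table fun j => hrun.measurable_φ hω j t

theorem IsBroadcastRun.measurable_h
    (hrun : IsBroadcastRun P ℱ reg f ν Q γ β ε x₀ h₀ x φ h i ξ m z)
    (hf : StronglyConvexAndSmooth f reg μ L) (hQ : IsUnbiasedCompressor ν Q δ) {ω : 𝒲}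
    (hω : ω ∈ reg) (t : ℕ) : Measurable[ℱ t] (h t ω) := by
  induction t with
  | zero =>
    have : h 0 ω = fun _ => h₀ ω := funext (hrun.h_zero ω)
    rw [this]; exact measurable_const
  | succ t ih =>
    have : h (t + 1) ω = fun a => h t ω a + β • m t ω a := funext (hrun.h_succ t ω)
    rw [this]
    have hle := ℱ.mono t.le_succ
    have hm : Measurable[ℱ (t + 1)] (m t ω) := by
      have e : m t ω = fun a => Q (ξ t ω a)
          (sagaGradient (f ω) (x t a) (fun j => φ t ω j a) (i t ω a) - h t ω a) :=
        funext (hrun.message t ω hω)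
      rw [e]
      exact hf.measurable_message hQ hω ((hrun.measurable_x t).mono hle le_rfl)
        ((hrun.measurable_table hω t).mono hle le_rfl) (ih.mono hle le_rfl)
        (hrun.i_measurable t ω hω) (hrun.ξ_measurable t ω hω)
    exact (ih.mono hle le_rfl).add (hm.const_smul β)

variable [IsProbabilityMeasure P] [IsProbabilityMeasure ν]

/-- Conditional bounds on functions of the state and of the draws of a regular worker. -/
theorem IsBroadcastRun.integrable_and_integral_le
    (hrun : IsBroadcastRun P ℱ reg f ν Q γ β ε x₀ h₀ x φ h i ξ m z)
    (hf : StronglyConvexAndSmooth f reg μ L) (hQ : IsUnbiasedCompressor ν Q δ) {ω : 𝒲}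
    (hω : ω ∈ reg) (t : ℕ) {G : Param p → (Fin J → Param p) → Param p → Fin J → S → ℝ}
    (hG : Measurable fun q : (Param p × (Fin J → Param p) × Param p) × Fin J × S =>
      G q.1.1 q.1.2.1 q.1.2.2 q.2.1 q.2.2)
    (hG0 : ∀ u v w j s, 0 ≤ G u v w j s) (hGi : ∀ u v w j, Integrable (G u v w j) ν)
    {K : Param p → (Fin J → Param p) → Param p → ℝ}
    (hK : ∀ u v w, (1 / (J : ℝ)) * ∑ j, ∫ s, G u v w j s ∂ν ≤ K u v w)
    (hKi : Integrable (fun a => K (x t a) (fun j => φ t ω j a) (h t ω a)) P) :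
    Integrable (fun a => G (x t a) (fun j => φ t ω j a) (h t ω a) (i t ω a) (ξ t ω a)) P ∧
      ∫ a, G (x t a) (fun j => φ t ω j a) (h t ω a) (i t ω a) (ξ t ω a) ∂P
        ≤ ∫ a, K (x t a) (fun j => φ t ω j a) (h t ω a) ∂P :=
  integrable_and_integral_le_of_forall_past ℱ t
    (Y := fun a => (x t a, (fun j => φ t ω j a), h t ω a))
    (G := fun y j s => G y.1 y.2.1 y.2.2 j s) (K := fun y => K y.1 y.2.1 y.2.2)
    ((hrun.measurable_x t).prodMk ((hrun.measurable_table hω t).prodMk (hrun.measurable_h hf hQ hω t)))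
    ((hrun.i_measurable t ω hω).mono (ℱ.le _) le_rfl)
    ((hrun.ξ_measurable t ω hω).mono (ℱ.le _) le_rfl)
    (hrun.indep_past t ω hω) (hrun.indep_draws t ω hω) (hrun.i_uniform t ω hω)
    (hrun.ξ_law t ω hω) hG (fun _ _ _ => hG0 _ _ _ _ _) (fun _ _ => hGi _ _ _ _)
    (fun _ => hK _ _ _) hKi

/-- All second moments of the regular processes at iteration `t` are finite. -/
structure HasFiniteMoments (P : Measure Ω) (reg : Finset 𝒲) (x : ℕ → Ω → Param p)
    (φ : ℕ → 𝒲 → Fin J → Ω → Param p) (h : ℕ → 𝒲 → Ω → Param p) (xs : Param p) (t : ℕ) :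
    Prop where
  dist : Integrable (fun a => ‖x t a - xs‖ ^ 2) P
  table : ∀ ω ∈ reg, Integrable (fun a => tableStaleness (x t a) (fun j => φ t ω j a)) P
  aux : ∀ ω ∈ reg, Integrable (fun a => ‖h t ω a‖ ^ 2) P

set_option maxHeartbeats 2000000 in
/-- One iteration preserves the finiteness of the moments and satisfies the four recursive
estimates for the distance, the staleness, the auxiliary vectors and the dispersion. -/
theorem IsBroadcastRun.moments_succ
    (hrun : IsBroadcastRun P ℱ reg f ν Q γ β ε x₀ h₀ x φ h i ξ m z)
    (hf : StronglyConvexAndSmooth f reg μ L) (hQ : IsUnbiasedCompressor ν Q δ) {σ : ℝ}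
    (hσ : BoundedOuterVariation f reg σ) (hJ : 0 < J)
    {W B : ℕ} (hW : W = Fintype.card 𝒲) (hB : B + reg.card = W) (hBW : (B : ℝ) < W / 2)
    (hμ : 0 < μ) (hR : 0 < reg.card) {xs : Param p}
    (hxs : ∀ y, globalCost f reg xs ≤ globalCost f reg y) (hβ0 : 0 ≤ β) (hβ : β * (1 + δ) ≤ 1)
    (hγ : 0 < γ) (hγL : 47 * (γ * L ^ 2) ≤ μ) (hγμ : 47 * (γ * μ) ≤ 1) {t : ℕ}
    (ht : HasFiniteMoments P reg x φ h xs t) {D S₁ H D' S' H' k e : ℝ}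
    (hD : D = ∫ a, ‖x t a - xs‖ ^ 2 ∂P)
    (hS : S₁ = ∫ a, (1 / (reg.card : ℝ))
      * ∑ ω ∈ reg, tableStaleness (x t a) (fun j => φ t ω j a) ∂P)
    (hH : H = ∫ a, (1 / (reg.card : ℝ)) * ∑ ω ∈ reg, ‖h t ω a‖ ^ 2 ∂P)
    (hD' : D' = ∫ a, ‖x (t + 1) a - xs‖ ^ 2 ∂P)
    (hS' : S' = ∫ a, (1 / (reg.card : ℝ))
      * ∑ ω ∈ reg, tableStaleness (x (t + 1) a) (fun j => φ (t + 1) ω j a) ∂P)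
    (hH' : H' = ∫ a, (1 / (reg.card : ℝ)) * ∑ ω ∈ reg, ‖h (t + 1) ω a‖ ^ 2 ∂P)
    (hk : k = Calpha W B ^ 2) (he : e = 2 * ε ^ 2 / ((W : ℝ) - 2 * B) ^ 2) :
    HasFiniteMoments P reg x φ h xs (t + 1) ∧ ∃ A : ℝ,
      D' ≤ (1 - 46 / 47 * (γ * μ)) * D + 48 / 47 * (γ / μ) * (2 * (k * A) + e) ∧
      S' ≤ (1 - 1 / (2 * (J : ℝ))) * S₁
        + 3 * J * γ ^ 2 * (2 * L ^ 2 * D + 2 * (2 * (k * A) + e)) ∧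
      H' ≤ (1 - β) * H + β * (L ^ 2 * S₁ + (σ ^ 2 + L ^ 2 * D)) ∧
      A ≤ (1 + δ) * (L ^ 2 * S₁) + 2 * δ * (σ ^ 2 + L ^ 2 * D + H) + σ ^ 2 := by
  have hδ := hQ.nonneg
  have hJ1 : (1 : ℝ) ≤ J := by exact_mod_cast hJ
  have mx := fun t => (hrun.measurable_x t).mono (ℱ.le t) le_rfl
  have mh : ∀ ω ∈ reg, ∀ t, Measurable (h t ω) :=
    fun ω hω t => (hrun.measurable_h hf hQ hω t).mono (ℱ.le t) le_rfl
  have mφ : ∀ ω ∈ reg, ∀ t, Measurable fun a j => φ t ω j a :=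
    fun ω hω t => (hrun.measurable_table hω t).mono (ℱ.le t) le_rfl
  -- square integrability of the gradients
  have lx : MemLp (x t) 2 P := by
    have h1 : MemLp (fun a => x t a - xs) 2 P :=
      (memLp_two_iff_integrable_sq_norm ((mx t).sub_const xs).aestronglyMeasurable).2 ht.dist
    have h2 : x t = fun a => (x t a - xs) + xs := by funext a; abel
    rw [h2]
    exact h1.add (memLp_const xs)
  have lh : ∀ ω ∈ reg, MemLp (h t ω) 2 P := fun ω hω =>
    (memLp_two_iff_integrable_sq_norm (mh ω hω t).aestronglyMeasurable).2 (ht.aux ω hω)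
  have lg : ∀ ω ∈ reg, MemLp (fun a => gradient (localCost f ω) (x t a)) 2 P := fun ω hω =>
    memLp_comp_of_norm_sub_le (hf.norm_gradient_localCost_sub_le hJ hω) lx
  have lG : MemLp (fun a => gradient (globalCost f reg) (x t a)) 2 P :=
    memLp_comp_of_norm_sub_le (hf.norm_gradient_globalCost_sub_le hJ hR) lx
  have sq : ∀ {X : Ω → Param p}, MemLp X 2 P → Integrable (fun a => ‖X a‖ ^ 2) P :=
    fun hX => (memLp_two_iff_integrable_sq_norm hX.aestronglyMeasurable).1 hX
  have iG := fun ω hω => sq (lg ω hω)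
  have iGh := fun ω hω => sq ((lg ω hω).sub (lh ω hω))
  have iGG := fun ω hω => sq ((lg ω hω).sub lG)
  -- the dispersion of the reconstructed vectors
  have hA : ∀ ω ∈ reg,
      Integrable (fun a => ‖h t ω a + m t ω a - gradient (globalCost f reg) (x t a)‖ ^ 2) P ∧
      ∫ a, ‖h t ω a + m t ω a - gradient (globalCost f reg) (x t a)‖ ^ 2 ∂P
        ≤ ∫ a, ((1 + δ) * (L ^ 2 * tableStaleness (x t a) (fun j => φ t ω j a))
          + δ * ‖gradient (localCost f ω) (x t a) - h t ω a‖ ^ 2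
          + ‖gradient (localCost f ω) (x t a) - gradient (globalCost f reg) (x t a)‖ ^ 2) ∂P := by
    intro ω hω
    have := hrun.integrable_and_integral_le hf hQ hω t
      (G := fun u v w j s => ‖w + Q s (sagaGradient (f ω) u v j - w)
        - gradient (globalCost f reg) u‖ ^ 2)
      (K := fun u v w => (1 + δ) * (L ^ 2 * tableStaleness u v)
          + δ * ‖gradient (localCost f ω) u - w‖ ^ 2
          + ‖gradient (localCost f ω) u - gradient (globalCost f reg) u‖ ^ 2)
      ?_ (fun _ _ _ _ _ => by positivity) ?_
      (fun u v w => hf.moment_reconstruction_le hJ hQ hω u v w _)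
      ((((ht.table ω hω).const_mul _).const_mul _).add ((iGh ω hω).const_mul δ) |>.add (iGG ω hω))
    · simpa only [← hrun.message t ω hω] using this
    · have hc : Measurable (gradient (globalCost f reg)) :=
        (continuous_of_norm_sub_le (hf.norm_gradient_globalCost_sub_le hJ hR)).measurable
      have h1 := hf.measurable_message hQ hω measurable_state_x measurable_state_φ
        measurable_state_h measurable_state_index (measurable_state_seed (S := S))
      exact (((measurable_state_h.add h1).sub (hc.comp measurable_state_x)).norm).pow_const 2
    · intro u v w j
      have := hQ.integrable_norm_add_smul_sq (w - gradient (globalCost f reg) u)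
        (sagaGradient (f ω) u v j - w) 1
      simpa only [one_smul, sub_add_eq_add_sub] using this
  -- the auxiliary vectors
  have hHs : ∀ ω ∈ reg, Integrable (fun a => ‖h (t + 1) ω a‖ ^ 2) P ∧
      ∫ a, ‖h (t + 1) ω a‖ ^ 2 ∂P ≤ ∫ a, ((1 - β) * ‖h t ω a‖ ^ 2
        + β * (L ^ 2 * tableStaleness (x t a) (fun j => φ t ω j a)
          + ‖gradient (localCost f ω) (x t a)‖ ^ 2)) ∂P := by
    intro ω hω
    have := hrun.integrable_and_integral_le hf hQ hω t
      (G := fun u v w j s => ‖w + β • Q s (sagaGradient (f ω) u v j - w)‖ ^ 2)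
      (K := fun u v w => (1 - β) * ‖w‖ ^ 2
        + β * (L ^ 2 * tableStaleness u v + ‖gradient (localCost f ω) u‖ ^ 2))
      ?_ (fun _ _ _ _ _ => by positivity) (fun _ _ _ _ => hQ.integrable_norm_add_smul_sq _ _ _)
      (fun u v w => hf.moment_auxiliary_le hJ hQ hβ0 hβ hω u v w)
      (((ht.aux ω hω).const_mul _).add
        ((((ht.table ω hω).const_mul _).add (iG ω hω)).const_mul β))
    · simpa only [← hrun.message t ω hω, ← hrun.h_succ t ω] using this
    · have h1 := hf.measurable_message hQ hω measurable_state_x measurable_state_φ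
        measurable_state_h measurable_state_index (measurable_state_seed (S := S))
      exact ((measurable_state_h.add (h1.const_smul β)).norm).pow_const 2
  -- the refreshed tables
  have hU : ∀ ω ∈ reg,
      Integrable (fun a => tableStaleness (x t a) (fun j => φ (t + 1) ω j a)) P ∧
      ∫ a, tableStaleness (x t a) (fun j => φ (t + 1) ω j a) ∂P
        ≤ ∫ a, (1 - 1 / (J : ℝ)) * tableStaleness (x t a) (fun j => φ t ω j a) ∂P := by
    intro ω hω
    -- The new table is compared with the old point `x t`, because this quantity depends only on the
    -- past and on the index of worker `ω`. The new point involves `z t`, hence all workers, and is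
    -- treated pathwise.
    have := hrun.integrable_and_integral_le hf hQ hω t
      (G := fun u v _ i _ => tableStaleness u (fun j => if j = i then u else v j))
      (K := fun u v _ => (1 - 1 / (J : ℝ)) * tableStaleness u v)
      ?_ (fun _ _ _ _ _ => tableStaleness_nonneg _ _) (fun _ _ _ _ => integrable_const _)
      ?_ ((ht.table ω hω).const_mul _)
    · simpa only [← hrun.φ_succ t ω hω] using this
    · exact measurable_tableStaleness_refresh measurable_state_x measurable_state_φ
        (measurable_state_index (S := S))
    · intro u v w
      simp only [integral_const, probReal_univ, one_smul]
      exact (average_tableStaleness_update hJ u v).le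
  -- pathwise estimates
  obtain ⟨A, hAdef⟩ : ∃ A : Ω → ℝ, A = fun a => (1 / (reg.card : ℝ))
    * ∑ ω ∈ reg, ‖h t ω a + m t ω a - gradient (globalCost f reg) (x t a)‖ ^ 2 := ⟨_, rfl⟩
  have iA : Integrable A P := by rw [hAdef]; exact integrable_average fun ω hω => (hA ω hω).1
  -- The median may depend on all draws and on arbitrary Byzantine messages, so it is eliminated
  -- outcome by outcome. Expectations are then needed only for quantities of single regular workers,
  -- and no independence between workers is used.
  have hz : ∀ a, ‖z t a - gradient (globalCost f reg) (x t a)‖ ^ 2 ≤ 2 * (k * A a) + e := by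
    intro a
    have := (hrun.z_median t a).norm_sub_sq_le reg hW hB hBW (gradient (globalCost f reg) (x t a))
    rw [hk, he, hAdef]
    exact this
  have iN : Integrable (fun a => 2 * (k * A a) + e) P :=
    ((iA.const_mul k).const_mul 2).add (integrable_const e)
  have hN : ∫ a, (2 * (k * A a) + e) ∂P = 2 * (k * ∫ a, A a ∂P) + e := by
    rw [integral_add ((iA.const_mul k).const_mul 2) (integrable_const e), integral_const_mul,
      integral_const_mul]
    simp
  have pD : ∀ a, ‖x (t + 1) a - xs‖ ^ 2 ≤ (1 - 46 / 47 * (γ * μ)) * ‖x t a - xs‖ ^ 2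
      + 48 / 47 * (γ / μ) * (2 * (k * A a) + e) := by
    intro a
    have := hf.norm_step_sub_sq_le hJ hR hμ hxs hγ hγL hγμ (x t a) (z t a)
    rw [hrun.x_succ]
    refine this.trans ?_
    gcongr
    exact hz a
  have pz : ∀ a, ‖z t a‖ ^ 2 ≤ 2 * L ^ 2 * ‖x t a - xs‖ ^ 2 + 2 * (2 * (k * A a) + e) := by
    intro a
    have h1 := norm_add_sq_le_two (gradient (globalCost f reg) (x t a))
      (z t a - gradient (globalCost f reg) (x t a))
    rw [add_sub_cancel] at h1
    have h2 := hf.norm_gradient_globalCost_sub_le hJ hR (x t a) xs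
    rw [gradient_globalCost_minimizer_eq_zero hxs, sub_zero] at h2
    have h3 : ‖gradient (globalCost f reg) (x t a)‖ ^ 2 ≤ L ^ 2 * ‖x t a - xs‖ ^ 2 := by
      rw [← mul_pow]; gcongr
    linarith [hz a]
  have pS : ∀ ω ∈ reg, ∀ a, tableStaleness (x (t + 1) a) (fun j => φ (t + 1) ω j a)
      ≤ (1 + 1 / (2 * (J : ℝ))) * tableStaleness (x t a) (fun j => φ (t + 1) ω j a)
        + 3 * J * γ ^ 2 * (2 * L ^ 2 * ‖x t a - xs‖ ^ 2 + 2 * (2 * (k * A a) + e)) := by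
    intro ω hω a
    have := tableStaleness_step_le hJ (x t a) (γ • z t a) (fun j => φ (t + 1) ω j a)
    rw [norm_smul, mul_pow, Real.norm_eq_abs, sq_abs] at this
    rw [hrun.x_succ]
    refine this.trans ?_
    -- The factor `3J` comes from `1 + 2J ≤ 3J`, valid for `J ≥ 1`.
    have h1 : (1 + 2 * (J : ℝ)) * (γ ^ 2 * ‖z t a‖ ^ 2) ≤ 3 * J * γ ^ 2 * ‖z t a‖ ^ 2 := by
      have : 0 ≤ γ ^ 2 * ‖z t a‖ ^ 2 := by positivity
      nlinarith
    have h2 := mul_le_mul_of_nonneg_left (pz a) (by positivity : 0 ≤ 3 * J * γ ^ 2)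
    linarith
  have iDr : Integrable (fun a => (1 - 46 / 47 * (γ * μ)) * ‖x t a - xs‖ ^ 2
      + 48 / 47 * (γ / μ) * (2 * (k * A a) + e)) P :=
    (ht.dist.const_mul _).add (iN.const_mul _)
  have iD : Integrable (fun a => ‖x (t + 1) a - xs‖ ^ 2) P := by
    refine iDr.mono' (((mx (t + 1)).sub_const xs).norm.pow_const 2).aestronglyMeasurable
      (Filter.Eventually.of_forall fun a => ?_)
    rw [Real.norm_of_nonneg (by positivity)]
    exact pD a
  have iV : Integrable (fun a => 2 * L ^ 2 * ‖x t a - xs‖ ^ 2 + 2 * (2 * (k * A a) + e)) P :=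
    (ht.dist.const_mul _).add (iN.const_mul _)
  have iSr : ∀ ω ∈ reg, Integrable (fun a =>
      (1 + 1 / (2 * (J : ℝ))) * tableStaleness (x t a) (fun j => φ (t + 1) ω j a)
        + 3 * J * γ ^ 2 * (2 * L ^ 2 * ‖x t a - xs‖ ^ 2 + 2 * (2 * (k * A a) + e))) P :=
    fun ω hω => ((hU ω hω).1.const_mul _).add (iV.const_mul _)
  have iS : ∀ ω ∈ reg, Integrable
      (fun a => tableStaleness (x (t + 1) a) (fun j => φ (t + 1) ω j a)) P := by
    intro ω hω
    refine (iSr ω hω).mono' (measurable_tableStaleness_comp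
      (mx (t + 1)) (mφ ω hω (t + 1))).aestronglyMeasurable
      (Filter.Eventually.of_forall fun a => ?_)
    rw [Real.norm_of_nonneg (tableStaleness_nonneg _ _)]
    exact pS ω hω a
  refine ⟨⟨iD, iS, fun ω hω => (hHs ω hω).1⟩, ∫ a, A a ∂P, ?_, ?_, ?_, ?_⟩
  · rw [hD', hD, ← hN, ← integral_const_mul, ← integral_const_mul,
      ← integral_add (ht.dist.const_mul _) (iN.const_mul _)]
    exact integral_mono iD iDr pD
  · have s1 : ∀ ω ∈ reg, ∫ a, tableStaleness (x (t + 1) a) (fun j => φ (t + 1) ω j a) ∂P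
        ≤ (1 - 1 / (2 * (J : ℝ))) * ∫ a, tableStaleness (x t a) (fun j => φ t ω j a) ∂P
          + 3 * J * γ ^ 2 * (2 * L ^ 2 * D + 2 * (2 * (k * ∫ a, A a ∂P) + e)) := by
      intro ω hω
      refine (integral_mono (iS ω hω) (iSr ω hω) (pS ω hω)).trans ?_
      rw [integral_add ((hU ω hω).1.const_mul _) (iV.const_mul _), integral_const_mul,
        integral_const_mul, integral_add (ht.dist.const_mul _) (iN.const_mul _), integral_const_mul,
        integral_const_mul, hN, ← hD]
      gcongr ?_ + _
      have h1 := (hU ω hω).2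
      rw [integral_const_mul] at h1
      have h0 : 0 ≤ ∫ a, tableStaleness (x t a) (fun j => φ t ω j a) ∂P :=
        integral_nonneg fun a => tableStaleness_nonneg _ _
      -- Loss by the step times gain by the refresh: `(1 + 1/(2J))(1 - 1/J) = 1 - 1/(2J) - 1/(2J²)`.
      calc _ ≤ (1 + 1 / (2 * (J : ℝ))) * ((1 - 1 / (J : ℝ))
            * ∫ a, tableStaleness (x t a) (fun j => φ t ω j a) ∂P) := by gcongr
        _ = ((1 + 1 / (2 * (J : ℝ))) * (1 - 1 / (J : ℝ)))
            * ∫ a, tableStaleness (x t a) (fun j => φ t ω j a) ∂P := by ring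
        _ ≤ _ := by
          gcongr
          have : (1 + 1 / (2 * (J : ℝ))) * (1 - 1 / (J : ℝ))
              = 1 - 1 / (2 * (J : ℝ)) - 1 / (2 * (J : ℝ) ^ 2) := by field_simp; ring
          rw [this]
          have : 0 ≤ 1 / (2 * (J : ℝ) ^ 2) := by positivity
          linarith
    rw [hS', hS, integral_const_mul, integral_const_mul, integral_finsetSum _ iS,
      integral_finsetSum _ ht.table]
    refine (average_mono s1).trans (le_of_eq ?_)
    rw [Finset.sum_add_distrib, ← Finset.mul_sum, Finset.sum_const, nsmul_eq_mul]
    have : (reg.card : ℝ) ≠ 0 := by positivity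
    field_simp
  · have iR : ∀ ω ∈ reg, Integrable (fun a => (1 - β) * ‖h t ω a‖ ^ 2
        + β * (L ^ 2 * tableStaleness (x t a) (fun j => φ t ω j a)
          + ‖gradient (localCost f ω) (x t a)‖ ^ 2)) P := fun ω hω =>
      ((ht.aux ω hω).const_mul _).add
        ((((ht.table ω hω).const_mul _).add (iG ω hω)).const_mul β)
    have h1 := integral_average_le hHs iR
    rw [hH']
    have i1 := (integrable_average ht.aux).const_mul (1 - β)
    have i2 := (integrable_average ht.table).const_mul (L ^ 2)
    have i3 : Integrable (fun a => σ ^ 2 + L ^ 2 * ‖x t a - xs‖ ^ 2) P :=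
      (integrable_const _).add (ht.dist.const_mul _)
    have i4 : Integrable (fun a => L ^ 2 * ((1 / (reg.card : ℝ))
        * ∑ ω ∈ reg, tableStaleness (x t a) (fun j => φ t ω j a))
        + (σ ^ 2 + L ^ 2 * ‖x t a - xs‖ ^ 2)) P := i2.add i3
    have e1 : (1 - β) * H + β * (L ^ 2 * S₁ + (σ ^ 2 + L ^ 2 * D))
        = ∫ a, ((1 - β) * ((1 / (reg.card : ℝ)) * ∑ ω ∈ reg, ‖h t ω a‖ ^ 2)
          + β * (L ^ 2 * ((1 / (reg.card : ℝ))
            * ∑ ω ∈ reg, tableStaleness (x t a) (fun j => φ t ω j a))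
            + (σ ^ 2 + L ^ 2 * ‖x t a - xs‖ ^ 2))) ∂P := by
      rw [integral_add i1 (i4.const_mul β), integral_const_mul (1 - β), integral_const_mul β,
        integral_add i2 i3, integral_const_mul (L ^ 2),
        integral_add (integrable_const _) (ht.dist.const_mul _), integral_const_mul (L ^ 2), ← hD, ← hS, ← hH]
      simp
    rw [e1]
    refine h1.trans (integral_mono (integrable_average iR) (i1.add (i4.const_mul β)) fun a => ?_)
    have h2 := mul_le_mul_of_nonneg_left
      (hf.average_norm_gradient_sq_le hJ hR hσ hxs (x t a)) hβ0
    simp only [Finset.sum_add_distrib, ← Finset.mul_sum]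
    linarith
  · have iR : ∀ ω ∈ reg, Integrable (fun a =>
        (1 + δ) * (L ^ 2 * tableStaleness (x t a) (fun j => φ t ω j a))
          + δ * ‖gradient (localCost f ω) (x t a) - h t ω a‖ ^ 2
          + ‖gradient (localCost f ω) (x t a) - gradient (globalCost f reg) (x t a)‖ ^ 2) P :=
      fun ω hω => (((ht.table ω hω).const_mul _).const_mul _).add ((iGh ω hω).const_mul δ)
        |>.add (iGG ω hω)
    have h1 := integral_average_le hA iR
    have i1 := ((integrable_average ht.table).const_mul (L ^ 2)).const_mul (1 + δ)
    have i2 : Integrable (fun a => σ ^ 2 + L ^ 2 * ‖x t a - xs‖ ^ 2) P :=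
      (integrable_const _).add (ht.dist.const_mul _)
    have i3 : Integrable (fun a => σ ^ 2 + L ^ 2 * ‖x t a - xs‖ ^ 2
        + (1 / (reg.card : ℝ)) * ∑ ω ∈ reg, ‖h t ω a‖ ^ 2) P := i2.add (integrable_average ht.aux)
    have i4 : Integrable (fun a => (1 + δ) * (L ^ 2 * ((1 / (reg.card : ℝ))
        * ∑ ω ∈ reg, tableStaleness (x t a) (fun j => φ t ω j a)))
        + 2 * δ * (σ ^ 2 + L ^ 2 * ‖x t a - xs‖ ^ 2
          + (1 / (reg.card : ℝ)) * ∑ ω ∈ reg, ‖h t ω a‖ ^ 2)) P := i1.add (i3.const_mul _)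
    have e1 : (1 + δ) * (L ^ 2 * S₁) + 2 * δ * (σ ^ 2 + L ^ 2 * D + H) + σ ^ 2
        = ∫ a, ((1 + δ) * (L ^ 2 * ((1 / (reg.card : ℝ))
            * ∑ ω ∈ reg, tableStaleness (x t a) (fun j => φ t ω j a)))
          + 2 * δ * (σ ^ 2 + L ^ 2 * ‖x t a - xs‖ ^ 2
            + (1 / (reg.card : ℝ)) * ∑ ω ∈ reg, ‖h t ω a‖ ^ 2) + σ ^ 2) ∂P := by
      rw [integral_add i4 (integrable_const _), integral_add i1 (i3.const_mul _),
        integral_const_mul (1 + δ), integral_const_mul (L ^ 2), integral_const_mul (2 * δ),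
        integral_add i2 (integrable_average ht.aux),
        integral_add (integrable_const _) (ht.dist.const_mul _), integral_const_mul (L ^ 2), ← hD, ← hS, ← hH]
      simp
    rw [e1, hAdef]
    refine h1.trans (integral_mono (integrable_average iR) (i4.add (integrable_const _))
      fun a => ?_)
    have h2 := hf.average_norm_gradient_sq_le hJ hR hσ hxs (x t a)
    have h3 := hσ (x t a)
    -- Separating `∇f_ω` from `h` is the origin of the factor `2δ` in the bound for `A`.
    have h4 : (1 / (reg.card : ℝ)) * ∑ ω ∈ reg, ‖gradient (localCost f ω) (x t a) - h t ω a‖ ^ 2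
        ≤ 2 * ((1 / (reg.card : ℝ)) * ∑ ω ∈ reg, ‖gradient (localCost f ω) (x t a)‖ ^ 2)
          + 2 * ((1 / (reg.card : ℝ)) * ∑ ω ∈ reg, ‖h t ω a‖ ^ 2) := by
      have : ∀ ω ∈ reg, ‖gradient (localCost f ω) (x t a) - h t ω a‖ ^ 2
          ≤ 2 * ‖gradient (localCost f ω) (x t a)‖ ^ 2 + 2 * ‖h t ω a‖ ^ 2 := by
        intro ω _
        have := norm_add_sq_le_two (gradient (localCost f ω) (x t a)) (-(h t ω a))
        rwa [← sub_eq_add_neg, norm_neg] at this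
      refine (average_mono this).trans (le_of_eq ?_)
      rw [Finset.sum_add_distrib, ← Finset.mul_sum, ← Finset.mul_sum]
      ring
    have h5 := mul_le_mul_of_nonneg_left h4 hδ
    have h6 := mul_le_mul_of_nonneg_left h2 hδ
    simp only [Finset.sum_add_distrib, ← Finset.mul_sum]
    linarith

end Run

/-! ### Step size conditions and the final recursion -/

/-- Consequences of the step size and compression conditions. -/
theorem step_size_bounds {J L μ δ β γ C : ℝ} (hJ : 1 ≤ J) (hμ : 0 < μ) (hμL : μ ≤ L) (hδ : 0 ≤ δ)
    (hC : 2 ≤ C) (hγ : 0 < γ)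
    (hγ' : γ ≤ β * μ / (4 * Real.sqrt 35 * Real.sqrt (1 + 5 * δ) * J ^ 2 * L ^ 2 * C)) :
    0 < β ∧ 560 * ((1 + 5 * δ) * J ^ 4 * L ^ 4 * C ^ 2 * γ ^ 2) ≤ β ^ 2 * μ ^ 2 ∧
      47 * (J ^ 2 * (γ * L ^ 2)) ≤ β * μ := by
  have hL : 0 < L := hμ.trans_le hμL
  have h1 : 1 ≤ Real.sqrt (1 + 5 * δ) := Real.one_le_sqrt.2 (by linarith)
  -- Together with `C ≥ 2` this gives `4 · (47/8) · 2 = 47`, the constant used throughout.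
  have h2 : 47 / 8 ≤ Real.sqrt 35 := Real.le_sqrt_of_sq_le (by norm_num)
  have hden : 0 < 4 * Real.sqrt 35 * Real.sqrt (1 + 5 * δ) * J ^ 2 * L ^ 2 * C := by positivity
  rw [le_div_iff₀ hden] at hγ'
  have hβμ : 0 < β * μ := lt_of_lt_of_le (by positivity) hγ'
  -- Positivity of `β` is forced by `0 < γ` and the upper bound on `γ`.
  have hβ : 0 < β := pos_of_mul_pos_left hβμ hμ.le
  refine ⟨hβ, ?_, ?_⟩
  -- Squaring the step size condition gives `16 · 35 = 560`.
  · have h3 := pow_le_pow_left₀ (by positivity) hγ' 2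
    have e : (γ * (4 * Real.sqrt 35 * Real.sqrt (1 + 5 * δ) * J ^ 2 * L ^ 2 * C)) ^ 2
        = 16 * Real.sqrt 35 ^ 2 * (Real.sqrt (1 + 5 * δ) ^ 2) * J ^ 4 * L ^ 4 * C ^ 2 * γ ^ 2 := by
      ring
    rw [e, Real.sq_sqrt (by norm_num), Real.sq_sqrt (by linarith), mul_pow] at h3
    linarith
  · calc 47 * (J ^ 2 * (γ * L ^ 2)) = γ * (4 * (47 / 8) * 1 * J ^ 2 * L ^ 2 * 2) := by ring
      _ ≤ γ * (4 * Real.sqrt 35 * Real.sqrt (1 + 5 * δ) * J ^ 2 * L ^ 2 * C) := by gcongr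
      _ ≤ _ := hγ'

theorem affine_recursion_le {T : ℕ → ℝ} {r Δ : ℝ} (hr : 0 ≤ r)
    (hT : ∀ t, T (t + 1) ≤ r * T t + (1 - r) * Δ) (t : ℕ) :
    T t ≤ r ^ t * (T 0 - Δ) + Δ := by
  induction t with
  | zero => simp
  | succ t ih =>
    calc T (t + 1) ≤ r * T t + (1 - r) * Δ := hT t
      _ ≤ r * (r ^ t * (T 0 - Δ) + Δ) + (1 - r) * Δ := by gcongr
      _ = _ := by ring

theorem theorem3
    {Ω : Type*} {mΩ : MeasurableSpace Ω} (P : Measure Ω) [IsProbabilityMeasure P]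
    (ℱ : Filtration ℕ mΩ)
    {𝒲 : Type*} [Fintype 𝒲] (reg : Finset 𝒲)
    {p J : ℕ} (hp : 1 ≤ p) (f : 𝒲 → Fin J → Param p → ℝ)
    {S : Type*} [MeasurableSpace S] (ν : Measure S) [IsProbabilityMeasure ν]
    (Q : S → Param p → Param p)
    (μ L σ δ γ β ε : ℝ)
    -- the number of workers and the number of Byzantine workers
    (W B : ℕ) (hW : W = Fintype.card 𝒲) (hB : B + reg.card = W) (hBW : (B : ℝ) < W / 2)
    -- assumptions on the costs; the solution; the compressor
    (hμ : 0 < μ) (hf : StronglyConvexAndSmooth f reg μ L) (hσ : BoundedOuterVariation f reg σ)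
    (xstar : Param p) (hxstar : ∀ y, globalCost f reg xstar ≤ globalCost f reg y)
    (hQ : IsUnbiasedCompressor ν Q δ)
    -- parameters
    (hε : 0 ≤ ε)
    (hδ : δ * Calpha W B ^ 2 ≤ μ ^ 2 / (56 * L ^ 2))
    (hβ : β * (1 + δ) ≤ 1)
    (hγ : 0 < γ)
    (hγ' : γ ≤ β * μ /
      (4 * Real.sqrt 35 * Real.sqrt (1 + 5 * δ) * (J : ℝ) ^ 2 * L ^ 2 * Calpha W B))
    -- a run of the algorithm
    (x₀ : Param p) (h₀ : 𝒲 → Param p)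
    (x : ℕ → Ω → Param p) (φ : ℕ → 𝒲 → Fin J → Ω → Param p) (h : ℕ → 𝒲 → Ω → Param p)
    (i : ℕ → 𝒲 → Ω → Fin J) (ξ : ℕ → 𝒲 → Ω → S) (m : ℕ → 𝒲 → Ω → Param p)
    (z : ℕ → Ω → Param p)
    (hrun : IsBroadcastRun P ℱ reg f ν Q γ β ε x₀ h₀ x φ h i ξ m z)
    (t : ℕ) :
    Integrable (fun a => ‖x t a - xstar‖ ^ 2) P ∧
    -- auxiliary vectors initialized at zero, or no compression
    ((δ = 0 ∨ ∀ ω ∈ reg, h₀ ω = 0) →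
      ∫ a, ‖x t a - xstar‖ ^ 2 ∂P ≤
        (1 - γ * μ / 2) ^ t * (‖x₀ - xstar‖ ^ 2 - broadcastDelta₂ W B μ δ σ ε)
          + broadcastDelta₂ W B μ δ σ ε) ∧
    -- arbitrary initialization of the auxiliary vectors
    ∫ a, ‖x t a - xstar‖ ^ 2 ∂P ≤
      (1 - γ * μ / 2) ^ t *
        (‖x₀ - xstar‖ ^ 2
          + 280 * δ * Calpha W B ^ 2 * γ / (17 * β * μ)
            * ((1 / (reg.card : ℝ)) * ∑ ω ∈ reg, ‖h₀ ω‖ ^ 2)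
          - broadcastDelta₂ W B μ δ σ ε)
        + broadcastDelta₂ W B μ δ σ ε := by
  have hR : 0 < reg.card := by
    have h1 : (B : ℝ) + reg.card = W := by exact_mod_cast hB
    have h2 : (0 : ℝ) ≤ B := by positivity
    have h3 : (0 : ℝ) < reg.card := by linarith
    exact_mod_cast h3
  have hJ : 0 < J := by
    obtain ⟨ω, -⟩ := Finset.card_pos.1 hR
    obtain ⟨a⟩ : Nonempty Ω := P.nonempty_of_neZero
    -- A sampled index exists because `Ω` and the set of regular workers are nonempty, so `Fin J` is
    -- nonempty.
    exact (i 0 ω a).pos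
  have hJ1 : (1 : ℝ) ≤ J := by exact_mod_cast hJ
  have hμL : μ ≤ L := hf.modulus_le_lipschitz hp hJ hR
  have hL : 0 < L := hμ.trans_le hμL
  have hδ0 := hQ.nonneg
  have hC := two_le_Calpha hBW
  obtain ⟨hβ0, hγk, hγL⟩ := step_size_bounds hJ1 hμ hμL hδ0 hC hγ hγ'
  have hβ1 : β ≤ 1 := (le_mul_of_one_le_right hβ0.le (by linarith)).trans hβ
  have hγL' : 47 * (γ * L ^ 2) ≤ μ := by
    calc 47 * (γ * L ^ 2) ≤ 47 * ((J : ℝ) ^ 2 * (γ * L ^ 2)) := mul_le_mul_of_nonneg_left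
          (le_mul_of_one_le_left (by positivity) (one_le_pow₀ hJ1)) (by norm_num)
      _ ≤ β * μ := hγL
      _ ≤ μ := mul_le_of_le_one_left hμ.le hβ1
  have hγμ : 47 * (γ * μ) ≤ 1 := by
    refine le_of_mul_le_mul_right ?_ hμ
    calc 47 * (γ * μ) * μ = 47 * (γ * μ ^ 2) := by ring
      _ ≤ 47 * (γ * L ^ 2) := by gcongr
      _ ≤ 1 * μ := by rw [one_mul]; exact hγL'
  have hk : 4 ≤ Calpha W B ^ 2 := by nlinarith
  have he : 0 ≤ 2 * ε ^ 2 / ((W : ℝ) - 2 * B) ^ 2 := by positivity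
  have hδk : 56 * (δ * Calpha W B ^ 2 * L ^ 2) ≤ μ ^ 2 := by
    rw [le_div_iff₀ (by positivity)] at hδ
    linarith
  obtain ⟨D, hD⟩ : ∃ D : ℕ → ℝ, ∀ t, D t = ∫ a, ‖x t a - xstar‖ ^ 2 ∂P := ⟨_, fun _ => rfl⟩
  obtain ⟨U, hU⟩ : ∃ U : ℕ → ℝ, ∀ t, U t = ∫ a, (1 / (reg.card : ℝ))
      * ∑ ω ∈ reg, tableStaleness (x t a) (fun j => φ t ω j a) ∂P := ⟨_, fun _ => rfl⟩
  obtain ⟨H, hH⟩ : ∃ H : ℕ → ℝ, ∀ t, H t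
      = ∫ a, (1 / (reg.card : ℝ)) * ∑ ω ∈ reg, ‖h t ω a‖ ^ 2 ∂P := ⟨_, fun _ => rfl⟩
  have hU0 : ∀ t, 0 ≤ U t := fun t => by
    rw [hU]
    exact integral_nonneg fun a => mul_nonneg (by positivity)
      (Finset.sum_nonneg fun ω _ => tableStaleness_nonneg _ _)
  have hH0 : ∀ t, 0 ≤ H t := fun t => by rw [hH]; exact integral_nonneg fun a => by positivity
  have step := fun t (ht : HasFiniteMoments P reg x φ h xstar t) =>
    hrun.moments_succ hf hQ hσ hJ hW hB hBW hμ hR hxstar hβ0.le hβ hγ hγL' hγμ ht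
      (hD t) (hU t) (hH t) (hD (t + 1)) (hU (t + 1)) (hH (t + 1)) rfl rfl
  -- All tables start at `x₀`, so the staleness contributes nothing to the initial value of the
  -- Lyapunov function.
  have hφ0 : ∀ ω ∈ reg, ∀ a, tableStaleness (x 0 a) (fun j => φ 0 ω j a) = 0 := by
    intro ω hω a
    simp [tableStaleness, hrun.x_zero, hrun.φ_zero ω hω]
  have fin : ∀ t, HasFiniteMoments P reg x φ h xstar t := by
    intro t
    induction t with
    | zero =>
      refine ⟨?_, fun ω hω => ?_, fun ω _ => ?_⟩
      · simpa only [hrun.x_zero] using integrable_const _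
      · simpa only [hφ0 ω hω] using integrable_const _
      · simpa only [hrun.h_zero] using integrable_const _
    | succ t ih => exact (step t ih).1
  have hD0 : D 0 = ‖x₀ - xstar‖ ^ 2 := by rw [hD]; simp [hrun.x_zero]
  have hU00 : U 0 = 0 := by
    rw [hU]
    have : ∀ a, ∑ ω ∈ reg, tableStaleness (x 0 a) (fun j => φ 0 ω j a) = 0 :=
      fun a => Finset.sum_eq_zero fun ω hω => hφ0 ω hω a
    simp [this]
  have hH00 : H 0 = (1 / (reg.card : ℝ)) * ∑ ω ∈ reg, ‖h₀ ω‖ ^ 2 := by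
    rw [hH]; simp [hrun.h_zero]
  obtain ⟨T, hT⟩ : ∃ T : ℕ → ℝ, ∀ t, T t = D t
      + 5 * J * γ * Calpha W B ^ 2 * L ^ 2 * (1 + 5 * δ) / μ * U t
      + 5 * δ * Calpha W B ^ 2 * γ / (β * μ) * H t := ⟨_, fun _ => rfl⟩
  have hrec : ∀ t, T (t + 1) ≤ (1 - γ * μ / 2) * T t
      + (1 - (1 - γ * μ / 2)) * broadcastDelta₂ W B μ δ σ ε := by
    intro t
    obtain ⟨-, A, h1, h2, h3, h4⟩ := step t (fin t)
    have hD0 : 0 ≤ D t := by rw [hD]; exact integral_nonneg fun a => by positivity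
    rw [hT, hT, sub_sub_cancel]
    exact lyapunov_step hJ1 hμ hμL hδ0 hβ0 hβ1 hγ hk he hδk hγk hγL hD0 (hU0 t) (hH0 t)
      h1 h2 h3 h4
  have hr : 0 ≤ 1 - γ * μ / 2 := by linarith
  have hmain : ∫ a, ‖x t a - xstar‖ ^ 2 ∂P ≤
      (1 - γ * μ / 2) ^ t *
        (‖x₀ - xstar‖ ^ 2
          + 280 * δ * Calpha W B ^ 2 * γ / (17 * β * μ)
            * ((1 / (reg.card : ℝ)) * ∑ ω ∈ reg, ‖h₀ ω‖ ^ 2)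
          - broadcastDelta₂ W B μ δ σ ε)
        + broadcastDelta₂ W B μ δ σ ε := by
    have hDT : D t ≤ T t := by
      have n1 : 0 ≤ 5 * J * γ * Calpha W B ^ 2 * L ^ 2 * (1 + 5 * δ) / μ * U t :=
        mul_nonneg (by positivity) (hU0 t)
      have n2 : 0 ≤ 5 * δ * Calpha W B ^ 2 * γ / (β * μ) * H t :=
        mul_nonneg (by positivity) (hH0 t)
      rw [hT]
      linarith
    rw [← hD, ← hH00]
    refine hDT.trans ((affine_recursion_le hr hrec t).trans ?_)
    -- The Lyapunov weight of `H` has constant 5, which is below the 280/17 of the claimed bound.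
    have hw : 5 * δ * Calpha W B ^ 2 * γ / (β * μ)
        ≤ 280 * δ * Calpha W B ^ 2 * γ / (17 * β * μ) := by
      have e : 280 * δ * Calpha W B ^ 2 * γ / (17 * β * μ)
          = 280 / 17 * (δ * Calpha W B ^ 2 * γ / (β * μ)) := by field_simp
      have e' : 5 * δ * Calpha W B ^ 2 * γ / (β * μ)
          = 5 * (δ * Calpha W B ^ 2 * γ / (β * μ)) := by ring
      rw [e, e']
      gcongr
      norm_num
    have := mul_le_mul_of_nonneg_right hw (hH0 0)
    rw [hT, hU00, hD0, mul_zero, add_zero]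
    gcongr
  refine ⟨(fin t).dist, fun hinit => ?_, hmain⟩
  have hzero : 280 * δ * Calpha W B ^ 2 * γ / (17 * β * μ)
      * ((1 / (reg.card : ℝ)) * ∑ ω ∈ reg, ‖h₀ ω‖ ^ 2) = 0 := by
    rcases hinit with h0 | h0
    · simp [h0]
    · rw [Finset.sum_eq_zero fun ω hω => by simp [h0 ω hω]]
      simp
  rwa [hzero, add_zero] at hmain
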